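/- **Theorem (improved spin-wave estimate).** For $n\ge 0$ let $\Lambda_n$ be one of the following two finite graphs with a marked vertex $v_0$. Free boundary condition: the subgraph of $\mathbb Z^2$ induced by $[-n,n]^2\cap\mathbb Z^2$, with $v_0=(0,0)$. Zero boundary condition: the graph with vertex set $([-n,n]^2\cap\mathbb Z^2)\cup\{\infty\}$ obtained from $\mathbb Z^2$ by keeping all edges with at least one endpoint in $[-n,n]^2$ and contracting the complement of $[-n,n]^2$ to the single vertex $\infty$ (parallel edges are kept), with $v_0=\infty$. Write $V$ and $E$ for the vertices and edges of $\Lambda_n$, and $d w(e)=w(y)-w(x)$ for an edge $e$ oriented from $x$ to $y$ in a fixed orientation. For $\beta>0$: * the Villain model is the random function $\theta:V\to[0,2\pi)$ with $\theta(v_0)=0$ and law $$\mathbb P^{Vil}_\beta(d\theta)\propto\prod_{e\in E}\sum_{m\in\mathbb Z}\exp\Big(-\frac\beta2\big(d\theta(e)+2\pi m\big)^2\Big)\prod_{v\ne v_0}d\theta(v);$$ * the Gaussian free field (GFF) is the random function $\phi:V\to\mathbb R$ with $\phi(v_0)=0$ and law $$\mathbb P^{GFF}_\beta(d\phi)\propto\exp\Big(-\frac\beta2\sum_{e\in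 E}(d\phi(e))^2\Big)\prod_{v\ne v_0}d\phi(v);$$ * $\operatorname{Var}^{IG}(a,\beta)$ is the variance of the integer-valued random variable $X$ with $\mathbb P[X=k]\propto e^{-\frac\beta2(k-a)^2}$, $k\in\mathbb Z$, and $$M(\beta)=(2\pi)^2\beta\inf_{a\in[0,1/2]}\operatorname{Var}^{IG}\big(a,(2\pi)^2\beta\big).$$ Then there is a constant $K$ such that for both boundary conditions, all $n\ge0$, all $\beta\ge\frac13$ and all vertices $v_1,v_2$ of $\Lambda_n$, $$\mathbb E^{Vil}_\beta\big[\cos(\theta(v_1)-\theta(v_2))\big]\le K\,\mathbb E^{GFF}_\beta\big[e^{i(\phi(v_1)-\phi(v_2))}\big]^{1+\frac{M(\beta)}2}=K\,\mathbb E^{GFF}_{\beta/(1+M(\beta)/2)}\big[e^{i(\phi(v_1)-\phi(v_2))}\big].$$ -/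

import Mathlib

open MeasureTheory
open scoped ComplexOrder

noncomputable section

namespace VillainModel

/-- A finite (multi-)graph with a marked vertex `root`. Every edge carries a reference orientation
from `src` to `tgt`; parallel edges are allowed. -/
structure RootedGraph where
  V : Type
  E : Type
  [fintypeV : Fintype V]
  [decEqV : DecidableEq V]
  [fintypeE : Fintype E]
  src : E → V
  tgt : E → V
  root : V

attribute [instance] RootedGraph.fintypeV RootedGraph.decEqV RootedGraph.fintypeE

/-! ### The graphs `Λ_n` with free and with zero boundary condition -/

/-- The square `[-n, n]² ∩ ℤ²`. -/
def box (n : ℕ) : Finset (ℤ × ℤ) :=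
  Finset.Icc (-(n : ℤ)) n ×ˢ Finset.Icc (-(n : ℤ)) n

/-- A nearest-neighbour edge of `ℤ²`: `(x, false)` is the horizontal edge from `x` to `x + (1, 0)`,
and `(x, true)` is the vertical edge from `x` to `x + (0, 1)`. -/
abbrev LatticeEdge : Type := (ℤ × ℤ) × Bool

/-- The second endpoint of an edge of `ℤ²`; the first one is `e.1`. -/
def LatticeEdge.head (e : LatticeEdge) : ℤ × ℤ :=
  if e.2 then (e.1.1, e.1.2 + 1) else (e.1.1 + 1, e.1.2)

/-- The edges of `ℤ²` with both endpoints in `[-n, n]²`. -/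
def innerEdges (n : ℕ) : Finset LatticeEdge :=
  (box n ×ˢ Finset.univ).filter fun e => LatticeEdge.head e ∈ box n

/-- The edges of `ℤ²` with at least one endpoint in `[-n, n]²`
(the first endpoint of such an edge lies in `[-(n+1), n+1]²`). -/
def touchingEdges (n : ℕ) : Finset LatticeEdge :=
  (box (n + 1) ×ˢ Finset.univ).filter fun e => e.1 ∈ box n ∨ LatticeEdge.head e ∈ box n

theorem innerEdges_fst_mem {n : ℕ} {e : LatticeEdge} (h : e ∈ innerEdges n) : e.1 ∈ box n :=
  (Finset.mem_product.1 (Finset.mem_filter.1 h).1).1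

theorem innerEdges_head_mem {n : ℕ} {e : LatticeEdge} (h : e ∈ innerEdges n) :
    LatticeEdge.head e ∈ box n :=
  (Finset.mem_filter.1 h).2

theorem origin_mem_box (n : ℕ) : ((0, 0) : ℤ × ℤ) ∈ box n := by
  simp [box]

/-- `Λ_n` with free boundary condition: the subgraph of `ℤ²` induced by `[-n, n]²`, rooted at the
origin. -/
def freeGraph (n : ℕ) : RootedGraph where
  V := box n
  E := innerEdges n
  src e := ⟨e.1.1, innerEdges_fst_mem e.2⟩
  tgt e := ⟨LatticeEdge.head e.1, innerEdges_head_mem e.2⟩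
  root := ⟨(0, 0), origin_mem_box n⟩

/-- The vertex of `[-n, n]² ∪ {∞}` to which a point of `ℤ²` is sent when the complement of
`[-n, n]²` is contracted to the single point `∞ = none`. -/
def contract (n : ℕ) (x : ℤ × ℤ) : Option (box n) :=
  if h : x ∈ box n then some ⟨x, h⟩ else none

/-- `Λ_n` with zero boundary condition: the vertices are those of `[-n, n]²` together with
`∞ = none`, the root, and every edge of `ℤ²` that leaves `[-n, n]²` becomes an edge to `∞`.
This is the planar dual of a square grid graph whose bounded faces form a `(2n+1) × (2n+1)` array;
in particular a corner has two edges to `∞` when `n ≥ 1`. -/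
def zeroGraph (n : ℕ) : RootedGraph where
  V := Option (box n)
  E := touchingEdges n
  src e := contract n e.1.1
  tgt e := contract n (LatticeEdge.head e.1)
  root := none

/-- The two boundary conditions. -/
inductive BoundaryCondition
  | free
  | zero

/-- The graph `Λ_n` with the given boundary condition. -/
def latticeGraph : BoundaryCondition → ℕ → RootedGraph
  | .free, n => freeGraph n
  | .zero, n => zeroGraph n

/-! ### `0`-forms -/

/-- Coordinates of a `0`-form, that is, of a real function on the vertices that vanishes at the
root: its values at the other vertices. -/
abbrev RootedGraph.Coord (G : RootedGraph) : Type := {v : G.V // v ≠ G.root} → ℝ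

/-- The `0`-form with the given coordinates: extension by `0` at the root. -/
def RootedGraph.toForm (G : RootedGraph) (x : G.Coord) (v : G.V) : ℝ :=
  if h : v = G.root then 0 else x ⟨v, h⟩

/-- The discrete exterior derivative of a function on the vertices. -/
def RootedGraph.d (G : RootedGraph) (w : G.V → ℝ) (e : G.E) : ℝ :=
  w (G.tgt e) - w (G.src e)

/-! ### The probability measures -/

/-- The probability measure proportional to `μ` (when `μ` has finite nonzero mass). -/
def normalize {Ω : Type*} [MeasurableSpace Ω] (μ : Measure Ω) : Measure Ω :=
  (μ Set.univ)⁻¹ • μ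

/-- The law on `ℤ` with weights proportional to `exp (-(β/2) (k - a)²)`. -/
def integerGaussian (a β : ℝ) : Measure ℤ :=
  normalize (Measure.count.withDensity fun k : ℤ =>
    ENNReal.ofReal (Real.exp (-(β / 2) * ((k : ℝ) - a) ^ 2)))

/-- The variance of an integer-valued Gaussian random variable. -/
def varIG (a β : ℝ) : ℝ :=
  ProbabilityTheory.variance (fun k : ℤ => (k : ℝ)) (integerGaussian a β)

/-- The error function `M(β) = (2π)² β inf_{a ∈ [0,1/2]} Var^IG(a, (2π)² β)`. -/
def errorFunction (β : ℝ) : ℝ :=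
  (2 * Real.pi) ^ 2 * β *
    ⨅ a : Set.Icc (0 : ℝ) (1 / 2), varIG (a : ℝ) ((2 * Real.pi) ^ 2 * β)

/-- The Gaussian free field on the `0`-forms of `G` at inverse temperature `β`, with density
proportional to `exp (-(β/2) ⟨dφ, dφ⟩)`. -/
def RootedGraph.gff (G : RootedGraph) (β : ℝ) : Measure G.Coord :=
  normalize (volume.withDensity fun x : G.Coord =>
    ENNReal.ofReal (Real.exp (-(β / 2) * ∑ e : G.E, G.d (G.toForm x) e ^ 2)))

/-- The Villain weight `∏_e ∑_{m ∈ ℤ} exp (-(β/2) (dθ(e) + 2πm)²)`. -/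
def RootedGraph.villainWeight (G : RootedGraph) (β : ℝ) (θ : G.V → ℝ) : ℝ :=
  ∏ e : G.E, ∑' m : ℤ, Real.exp (-(β / 2) * (G.d θ e + 2 * Real.pi * (m : ℝ)) ^ 2)

/-- The Villain model on `G` at inverse temperature `β`: the law on the `0`-forms with values in
`[0, 2π)` with density proportional to the Villain weight. -/
def RootedGraph.villain (G : RootedGraph) (β : ℝ) : Measure G.Coord :=
  normalize ((volume.restrict
      (Set.univ.pi fun _ : {v : G.V // v ≠ G.root} => Set.Ico (0 : ℝ) (2 * Real.pi))).withDensity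
    fun x : G.Coord => ENNReal.ofReal (G.villainWeight β (G.toForm x)))

/-! ### The two-point functions -/

/-- `E^Vil_β [cos (θ(v₁) - θ(v₂))]`. -/
def RootedGraph.villainTwoPoint (G : RootedGraph) (β : ℝ) (v₁ v₂ : G.V) : ℝ :=
  ∫ x, Real.cos (G.toForm x v₁ - G.toForm x v₂) ∂(G.villain β)

/-- `E^GFF_β [exp (i (φ(v₁) - φ(v₂)))]`. -/
def RootedGraph.gffTwoPoint (G : RootedGraph) (β : ℝ) (v₁ v₂ : G.V) : ℂ :=
  ∫ x, Complex.exp (Complex.I * ((G.toForm x v₁ - G.toForm x v₂ : ℝ) : ℂ)) ∂(G.gff β)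

end VillainModel

end

/-! Let `ψ` be the potential of the unit flow from `v₁` to `v₂`, and `R = ψ v₁ - ψ v₂` its Dirichlet
energy. Completing the square gives the GFF two-point function `exp (-R / (2β))` (`gffTwoPoint_eq`),
so the claimed identity is algebra and the inequality asks for a bound by `exp (-(R / (2β)) (1 +
M(β)/2))` up to a constant.

For the Villain model, shift `θ` to `θ + i ψ / β`. By periodicity and holomorphy this does not
change the integral (`setIntegral_box_shift`). The observable contributes `exp (-R / β)`. On an edge
with increment `D = dψ(e)`, the modulus of the shifted weight is the real weight times `exp (D² /
(2β))` times the modulus of the characteristic function of an integer Gaussian at frequency `2πD`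
(`norm_theta_eq`). Bounding that characteristic function by `1` gives `exp (-R / (2β))`, the usual
spin-wave estimate. The improvement uses its decay: for `|t| ≤ 0.4` its modulus is at most `exp (-v
t² / 4)`, where `v` is the infimum of the variances, uniformly in the centre (`norm_gaussSum_le`).
Summing `v (2πD)² / 4` over the edges gives `π² v R`, exactly the exponent `(M(β)/2) R / (2β)`.

The small-frequency condition may fail on edges where the flow is large. Each of these costs at most
a factor `exp π²`, so it remains to bound their number independently of `n`, `v₁`, `v₂`. By
reciprocity, `dψ(e)` is, up to sign, the difference between the values at `v₁` and `v₂` of the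
potential `g` of a unit flow across `e`. This `g` has energy at most `1`, and by the maximum
principle its oscillation outside a square around `e` is controlled by that on the boundary of the
square. Cauchy–Schwarz on each of `N` concentric squares and the divergence of the harmonic series
make the oscillation small (`exists_radius`). Hence only edges within distance `N` of `v₁` or `v₂`,
or a bounded number in a small box, can be bad (`latticeGraph_exists_bad`). -/

namespace VillainModel

/-! ### Potential theory on a finite connected graph. -/

namespace RootedGraph

variable (G : RootedGraph)

/-- Connectedness, in analytic form: a function with vanishing derivative is constant. -/
def IsConn : Prop :=
  ∀ w : G.V → ℝ, (∀ e, G.d w e = 0) → ∀ u v, w u = w v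

/-- `ψ` is a potential of the unit flow from `v₁` to `v₂`. -/
def IsPotential (ψ : G.V → ℝ) (v₁ v₂ : G.V) : Prop :=
  ∀ w : G.V → ℝ, ∑ e, G.d ψ e * G.d w e = w v₁ - w v₂

/-- `toForm` as a linear map. -/
def toFormₗ : G.Coord →ₗ[ℝ] (G.V → ℝ) where
  toFun := G.toForm
  map_add' x y := by
    funext v
    by_cases h : v = G.root <;> simp [toForm, h]
  map_smul' c x := by
    funext v
    by_cases h : v = G.root <;> simp [toForm, h]

theorem d_add (f g : G.V → ℝ) (e : G.E) : G.d (f + g) e = G.d f e + G.d g e := by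
  simp only [d, Pi.add_apply]; ring

theorem d_smul (c : ℝ) (f : G.V → ℝ) (e : G.E) : G.d (c • f) e = c * G.d f e := by
  simp only [d, Pi.smul_apply, smul_eq_mul]; ring

/-- The Dirichlet form in coordinates. -/
def dirichletForm : LinearMap.BilinForm ℝ G.Coord :=
  LinearMap.mk₂ ℝ (fun x y => ∑ e, G.d (G.toForm x) e * G.d (G.toForm y) e)
    (fun x x' y => by
      have h : G.toForm (x + x') = G.toForm x + G.toForm x' := G.toFormₗ.map_add x x'
      simp only [h, d_add, add_mul, Finset.sum_add_distrib])
    (fun c x y => by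
      have h : G.toForm (c • x) = c • G.toForm x := G.toFormₗ.map_smul c x
      simp only [h, d_smul, smul_eq_mul, mul_assoc, Finset.mul_sum])
    (fun x y y' => by
      have h : G.toForm (y + y') = G.toForm y + G.toForm y' := G.toFormₗ.map_add y y'
      simp only [h, d_add, mul_add, Finset.sum_add_distrib])
    (fun c x y => by
      have h : G.toForm (c • y) = c • G.toForm y := G.toFormₗ.map_smul c y
      simp only [h, d_smul, smul_eq_mul, Finset.mul_sum]
      exact Finset.sum_congr rfl fun e _ => by ring)

theorem dirichletForm_apply (x y : G.Coord) :
    G.dirichletForm x y = ∑ e, G.d (G.toForm x) e * G.d (G.toForm y) e := rfl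

theorem toForm_root (x : G.Coord) : G.toForm x G.root = 0 := by simp [toForm]

theorem toForm_coe (x : G.Coord) (v : {v : G.V // v ≠ G.root}) : G.toForm x v = x v := by
  simp [toForm, v.2]

variable {G}

theorem toForm_restrict {w : G.V → ℝ} (hw : w G.root = 0) : G.toForm (fun v => w v) = w := by
  funext v
  by_cases h : v = G.root
  · subst h; simp [toForm, hw]
  · simp [toForm, h]

theorem dirichletForm_pos (hG : G.IsConn) {x : G.Coord} (hx : x ≠ 0) :
    0 < G.dirichletForm x x := by
  rw [dirichletForm_apply]
  refine lt_of_le_of_ne (Finset.sum_nonneg fun e _ => mul_self_nonneg _) fun h => hx ?_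
  have h0 := (Finset.sum_eq_zero_iff_of_nonneg fun e _ => mul_self_nonneg _).1 h.symm
  funext v
  have := hG (G.toForm x) (fun e => by simpa using h0 e (Finset.mem_univ e)) v G.root
  rwa [toForm_root, toForm_coe] at this

/-- The Dirichlet form is positive definite on forms vanishing at the root, so it represents every
linear functional, in particular `w ↦ w v₁ - w v₂`. The restriction on the test function is lifted
by subtracting the constant `w G.root`, which changes neither side. -/
theorem exists_potential (hG : G.IsConn) (v₁ v₂ : G.V) :
    ∃ x : G.Coord, G.IsPotential (G.toForm x) v₁ v₂ := by
  have hinj : Function.Injective G.dirichletForm := by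
    refine (injective_iff_map_eq_zero _).2 fun x hx => ?_
    by_contra hne
    have := dirichletForm_pos hG hne
    rw [hx] at this
    simp at this
  have hfr : Module.finrank ℝ G.Coord = Module.finrank ℝ (Module.Dual ℝ G.Coord) :=
    (Subspace.dual_finrank_eq (K := ℝ) (V := G.Coord)).symm
  have hsurj := (LinearMap.injective_iff_surjective_of_finrank_eq_finrank hfr).1 hinj
  obtain ⟨x, hx⟩ := hsurj
    (((LinearMap.proj v₁ : (G.V → ℝ) →ₗ[ℝ] ℝ) - LinearMap.proj v₂) ∘ₗ G.toFormₗ)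
  refine ⟨x, fun w => ?_⟩
  have h := LinearMap.congr_fun hx (fun v => w v - w G.root)
  rw [dirichletForm_apply] at h
  have hr := toForm_restrict (G := G) (w := fun v => w v - w G.root) (by simp)
  have hr' : G.toFormₗ (fun v => w v - w G.root) = fun v => w v - w G.root := hr
  rw [hr] at h
  simp only [LinearMap.comp_apply, hr', LinearMap.sub_apply, LinearMap.proj_apply] at h
  have hd : ∀ e, G.d (fun v => w v - w G.root) e = G.d w e := fun e => by simp [d]
  simp only [hd] at h
  rw [h]; ring

theorem IsPotential.energy {ψ : G.V → ℝ} {v₁ v₂ : G.V} (h : G.IsPotential ψ v₁ v₂) :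
    ∑ e, G.d ψ e ^ 2 = ψ v₁ - ψ v₂ := by
  simpa only [sq] using h ψ

theorem IsPotential.neg {ψ : G.V → ℝ} {v₁ v₂ : G.V} (h : G.IsPotential ψ v₁ v₂) :
    G.IsPotential (-ψ) v₂ v₁ := fun w => by
  have hd : ∀ e, G.d (-ψ) e = -G.d ψ e := fun e => by simp [d]; ring
  simp only [hd, neg_mul, Finset.sum_neg_distrib, h w]; ring

/-- Both differences are the Dirichlet pairing of `ψ` with `g`. This turns a question about the flow
through one edge into one about the potential of that edge, seen from the poles. -/
theorem IsPotential.reciprocity {ψ g : G.V → ℝ} {v₁ v₂ x y : G.V} (h : G.IsPotential ψ v₁ v₂)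
    (hg : G.IsPotential g x y) : ψ x - ψ y = g v₁ - g v₂ := by
  rw [← h g, ← hg ψ]
  exact Finset.sum_congr rfl fun e _ => mul_comm _ _

/-- Weak maximum principle: a potential is bounded on `D` by any bound on the vertices adjacent to
`D`, when the poles are outside `D`. -/
theorem IsPotential.le_of_boundary (hG : G.IsConn) {g : G.V → ℝ} {x y : G.V}
    (hg : G.IsPotential g x y) (D : Set G.V) (hx : x ∉ D) (hy : y ∉ D) (M : ℝ)
    (h₁ : ∀ e, G.src e ∈ D → G.tgt e ∈ D ∨ g (G.tgt e) ≤ M)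
    (h₂ : ∀ e, G.tgt e ∈ D → G.src e ∈ D ∨ g (G.src e) ≤ M) {v : G.V} (hv : v ∈ D) :
    g v ≤ M := by
  classical
  -- Test against the excess of `g` over `M`, cut off outside `D`. Since `g ≤ M` at the outer end of
  -- every edge leaving `D`, the energy density of `w` is at most its pairing with `g`. That pairing
  -- sums to zero because `w` vanishes at both poles, so `w` is constant.
  set w : G.V → ℝ := fun v => if v ∈ D then max (g v - M) 0 else 0 with hw
  have hwe : ∀ e, G.d w e ^ 2 ≤ G.d g e * G.d w e := by
    intro e
    have e1 := h₁ e
    have e2 := h₂ e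
    simp only [hw, d]
    by_cases hs : G.src e ∈ D <;> by_cases ht : G.tgt e ∈ D <;> simp only [hs, ht, if_true, if_false,
      true_or, false_or, forall_true_left, false_imp_iff] at e1 e2 ⊢
    · rcases le_total (g (G.src e) - M) 0 with a | a <;>
        rcases le_total (g (G.tgt e) - M) 0 with b | b <;> simp only [max_eq_left, max_eq_right, a, b]
        <;> nlinarith
    · rcases le_total (g (G.src e) - M) 0 with a | a <;>
        simp only [max_eq_left, max_eq_right, a] <;> nlinarith
    · rcases le_total (g (G.tgt e) - M) 0 with a | a <;>
        simp only [max_eq_left, max_eq_right, a] <;> nlinarith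
    · simp
  have hsum : ∑ e, G.d w e ^ 2 ≤ 0 := by
    calc ∑ e, G.d w e ^ 2 ≤ ∑ e, G.d g e * G.d w e := Finset.sum_le_sum fun e _ => hwe e
      _ = 0 := by rw [hg w]; simp [hw, hx, hy]
  have h0 := (Finset.sum_eq_zero_iff_of_nonneg fun e _ => sq_nonneg _).1
    (le_antisymm hsum (Finset.sum_nonneg fun e _ => sq_nonneg _))
  have := hG w (fun e => by simpa using h0 e (Finset.mem_univ e)) v x
  simp only [hw, hv, hx, if_true, if_false] at this
  have := le_max_left (g v - M) 0
  linarith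

/-- The maximum and minimum of a potential are at the poles. -/
theorem IsPotential.sub_le (hG : G.IsConn) {g : G.V → ℝ} {x y : G.V}
    (hg : G.IsPotential g x y) (u v : G.V) : g u - g v ≤ g x - g y := by
  have key : ∀ {g : G.V → ℝ} {x y : G.V}, G.IsPotential g x y → ∀ u, g u ≤ g x := by
    intro g x y hg u
    have hxy : g y ≤ g x := by
      have := hg.energy
      have h2 : 0 ≤ ∑ e, G.d g e ^ 2 := Finset.sum_nonneg fun e _ => sq_nonneg _
      linarith
    by_cases hu : u = x ∨ u = y
    · rcases hu with rfl | rfl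
      · exact le_rfl
      · exact hxy
    · refine hg.le_of_boundary hG {v | ¬(v = x ∨ v = y)} (by simp) (by simp) (g x) ?_ ?_ hu
      all_goals
        intro e _
        by_cases h : G.src e = x ∨ G.src e = y <;> by_cases h' : G.tgt e = x ∨ G.tgt e = y <;>
          simp only [Set.mem_ofPred_eq, h, h', not_true, not_false_iff, false_or, true_or]
        all_goals
          first
            | (rcases h' with h' | h' <;> rw [h'] <;> first | exact le_rfl | exact hxy)
            | (rcases h with h | h <;> rw [h]; first | exact le_rfl | exact hxy)
  have h1 := key hg u
  have h2 := key hg.neg v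
  simp only [Pi.neg_apply] at h2
  linarith

/-- The total energy equals the drop `a` across `e`, while `e` alone contributes `a²`; hence `a² ≤
a`. -/
theorem IsPotential.edge_energy_le_one {g : G.V → ℝ} {e : G.E}
    (hg : G.IsPotential g (G.src e) (G.tgt e)) : g (G.src e) - g (G.tgt e) ≤ 1 := by
  have h1 := hg.energy
  have h2 : G.d g e ^ 2 ≤ ∑ e, G.d g e ^ 2 :=
    Finset.single_le_sum (f := fun e => G.d g e ^ 2) (fun e _ => sq_nonneg _) (Finset.mem_univ e)
  rw [h1, d] at h2
  nlinarith

/-- By reciprocity the increment is a difference of values of the potential of `e`, which is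
extremal at the two ends of `e`, where the drop is at most `1`. -/
theorem IsPotential.abs_d_le_one (hG : G.IsConn) {ψ : G.V → ℝ} {v₁ v₂ : G.V}
    (h : G.IsPotential ψ v₁ v₂) (e : G.E) : |G.d ψ e| ≤ 1 := by
  obtain ⟨x, hx⟩ := exists_potential hG (G.src e) (G.tgt e)
  have h1 := h.reciprocity hx
  have h2 := hx.sub_le hG v₁ v₂
  have h3 := hx.sub_le hG v₂ v₁
  have h4 := hx.edge_energy_le_one
  rw [d, abs_le]
  constructor <;> linarith

end RootedGraph

/-! ### The Gaussian free field. -/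

/-- The characteristic function of a centred Gaussian vector whose density is given by a positive
definite bilinear form. -/
theorem integral_cexp_bilinForm {ι : Type*} [Fintype ι] (B : LinearMap.BilinForm ℝ (ι → ℝ))
    (hs : LinearMap.IsSymm B) (hpos : ∀ x, x ≠ 0 → 0 < B x x) {β : ℝ} (hβ : 0 < β) (p : ι → ℝ) :
    (∫ x : ι → ℝ, Complex.exp (Complex.I * (B p x : ℝ) - (β / 2 * B x x : ℝ))) =
      Complex.exp ((-(B p p) / (2 * β) : ℝ)) *
        (∫ x : ι → ℝ, Complex.exp ((-(β / 2) * B x x : ℝ))) ∧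
    (∫ x : ι → ℝ, Complex.exp ((-(β / 2) * B x x : ℝ))) ≠ 0 := by
  classical
  obtain ⟨v₀, hv₀⟩ := LinearMap.BilinForm.exists_orthogonal_basis hs
  set eι : Fin (Module.finrank ℝ (ι → ℝ)) ≃ ι :=
    Fintype.equivOfCardEq (by simp) with heι
  set v₁ := v₀.reindex eι with hv₁
  have hv₁o : ∀ i j, i ≠ j → B (v₁ i) (v₁ j) = 0 := by
    intro i j hij
    have := hv₀ (i := eι.symm i) (j := eι.symm j) (by simpa using hij)
    simpa [hv₁] using this
  have hc : ∀ i, 0 < B (v₁ i) (v₁ i) := fun i => hpos _ (v₁.ne_zero i)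
  set s : ι → ℝ := fun i => (Real.sqrt (B (v₁ i) (v₁ i)))⁻¹ with hsdef
  have hs0 : ∀ i, s i ≠ 0 := fun i => (inv_pos.2 (Real.sqrt_pos.2 (hc i))).ne'
  set v := v₁.isUnitSMul (w := s) (fun i => (hs0 i).isUnit) with hv
  have hvo : ∀ i j, B (v i) (v j) = if i = j then 1 else 0 := by
    intro i j
    simp only [hv, Module.Basis.isUnitSMul_apply, map_smul, LinearMap.smul_apply, smul_eq_mul]
    split_ifs with h
    · subst h
      have := Real.mul_self_sqrt (hc i).le
      have h0 := (Real.sqrt_pos.2 (hc i)).ne'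
      simp only [hsdef]
      field_simp
      nlinarith
    · rw [hv₁o i j h]; simp
  set A : (ι → ℝ) ≃ₗ[ℝ] (ι → ℝ) := v.equivFun.symm with hA
  have hAy : ∀ y, A y = ∑ i, y i • v i := fun y => v.equivFun_symm_apply y
  have hpA : ∀ q y, B q (A y) = ∑ i, y i * B q (v i) := by
    intro q y
    simp [hAy, map_sum]
  have hAA : ∀ y, B (A y) (A y) = ∑ i, y i ^ 2 := by
    intro y
    rw [hpA]
    refine Finset.sum_congr rfl fun i _ => ?_
    have : B (A y) (v i) = y i := by
      simp [hAy, map_sum, LinearMap.sum_apply, hvo]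
    rw [this, sq]
  have hpp : B p p = ∑ i, B p (v i) ^ 2 := by
    obtain ⟨y, rfl⟩ := A.surjective p
    rw [hAA]
    refine Finset.sum_congr rfl fun i _ => ?_
    simp [hAy, map_sum, LinearMap.sum_apply, hvo]
  have hdet : LinearMap.det (A : (ι → ℝ) →ₗ[ℝ] (ι → ℝ)) ≠ 0 := (LinearEquiv.isUnit_det' A).ne_zero
  have hmap := Real.map_linearMap_volume_pi_eq_smul_volume_pi hdet
  set c := ENNReal.ofReal |(LinearMap.det (A : (ι → ℝ) →ₗ[ℝ] (ι → ℝ)))⁻¹| with hcdef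
  have hc0 : c.toReal ≠ 0 := by
    rw [hcdef, ENNReal.toReal_ofReal (abs_nonneg _)]
    exact abs_ne_zero.2 (inv_ne_zero hdet)
  -- In coordinates orthonormal for `B` both integrals become standard Gaussian integrals. The
  -- Jacobian `c` is common to both, so only `c ≠ 0` matters.
  have hcv : ∀ f : (ι → ℝ) → ℂ, Continuous f → c.toReal • ∫ x, f x = ∫ y, f (A y) := by
    intro f hf
    rw [← integral_smul_measure, ← hmap]
    exact integral_map (A : (ι → ℝ) →ₗ[ℝ] (ι → ℝ)).continuous_of_finiteDimensional.aemeasurable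
      hf.aestronglyMeasurable
  have hBc : Continuous fun x : ι → ℝ => B p x := (B p).continuous_of_finiteDimensional
  have hBxx : Continuous fun x : ι → ℝ => B x x := by
    have : (fun x : ι → ℝ => B x x) = fun x => ∑ i, (A.symm x i) ^ 2 := by
      funext x
      rw [← hAA, A.apply_symm_apply]
    rw [this]
    have h := (A.symm : (ι → ℝ) →ₗ[ℝ] (ι → ℝ)).continuous_of_finiteDimensional
    exact continuous_finsetSum _ fun i _ => ((continuous_apply i).comp h).pow 2
  have h1 := hcv (fun x => Complex.exp (Complex.I * (B p x : ℝ) - (β / 2 * B x x : ℝ)))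
    (by fun_prop)
  have h2 := hcv (fun x => Complex.exp ((-(β / 2) * B x x : ℝ))) (by fun_prop)
  have hre : 0 < ((β / 2 : ℝ) : ℂ).re := by simpa using hβ
  have g1 := GaussianFourier.integral_cexp_neg_mul_sum_add hre
    (fun i => Complex.I * (B p (v i) : ℝ))
  have g2 := GaussianFourier.integral_cexp_neg_mul_sum_add hre (fun _ : ι => (0 : ℂ))
  have e1 : (∫ y, Complex.exp (Complex.I * (B p (A y) : ℝ) - (β / 2 * B (A y) (A y) : ℝ))) =
      ∫ y : ι → ℝ, Complex.exp (-((β / 2 : ℝ) : ℂ) * ∑ i, (y i : ℂ) ^ 2 +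
        ∑ i, (Complex.I * (B p (v i) : ℝ)) * (y i : ℂ)) := by
    congr 1; funext y; congr 1
    rw [hpA, hAA]
    push_cast
    rw [Finset.mul_sum, neg_mul, sub_eq_neg_add]
    congr 1
    exact Finset.sum_congr rfl fun i _ => by ring
  have e2 : (∫ y, Complex.exp ((-(β / 2) * B (A y) (A y) : ℝ))) =
      ∫ y : ι → ℝ, Complex.exp (-((β / 2 : ℝ) : ℂ) * ∑ i, (y i : ℂ) ^ 2 +
        ∑ i, (0 : ℂ) * (y i : ℂ)) := by
    congr 1; funext y; congr 1
    rw [hAA]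
    push_cast
    simp
  rw [e1, g1] at h1
  rw [e2, g2] at h2
  have hc0' : (c.toReal : ℂ) ≠ 0 := by exact_mod_cast hc0
  simp only [Complex.real_smul] at h1 h2
  refine ⟨mul_left_cancel₀ hc0' ?_, fun h0 => ?_⟩
  swap
  · rw [h0, mul_zero] at h2
    refine (mul_ne_zero ?_ (Complex.exp_ne_zero _)) h2.symm
    rw [Complex.cpow_def_of_ne_zero]
    · exact Complex.exp_ne_zero _
    · exact div_ne_zero (by exact_mod_cast Real.pi_ne_zero) (by exact_mod_cast (half_pos hβ).ne')
  rw [h1, mul_left_comm, h2]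
  simp only [ne_eq, OfNat.ofNat_ne_zero, not_false_eq_true, zero_pow, Finset.sum_const_zero,
    zero_div, Complex.exp_zero, mul_one]
  rw [mul_comm]
  congr 2
  rw [hpp]
  push_cast
  simp only [mul_pow, Complex.I_sq, neg_one_mul, Finset.sum_neg_distrib]
  congr 1
  ring

/-- Integration against `normalize (μ.withDensity f)` for a continuous density. -/
theorem integral_normalize_withDensity {Ω E : Type*} [MeasurableSpace Ω] [NormedAddCommGroup E]
    [NormedSpace ℝ E] {μ : Measure Ω} {f : Ω → ℝ} (hf : Measurable f) (h0 : ∀ x, 0 ≤ f x)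
    (hi : Integrable f μ) (g : Ω → E) :
    ∫ x, g x ∂(normalize (μ.withDensity fun x => ENNReal.ofReal (f x))) =
      (∫ x, f x ∂μ)⁻¹ • ∫ x, f x • g x ∂μ := by
  rw [normalize, integral_smul_measure, withDensity_apply _ MeasurableSet.univ,
    Measure.restrict_univ, ← ofReal_integral_eq_lintegral_ofReal hi (ae_of_all _ h0),
    integral_withDensity_eq_integral_toReal_smul hf.ennreal_ofReal
      (ae_of_all _ fun _ => ENNReal.ofReal_lt_top), ENNReal.toReal_inv,
    ENNReal.toReal_ofReal (integral_nonneg h0)]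
  simp only [ENNReal.toReal_ofReal (h0 _)]

namespace RootedGraph

variable {G : RootedGraph}

/-- The two-point function of the Gaussian free field. -/
theorem gffTwoPoint_eq (hG : G.IsConn) {ψ : G.Coord} {v₁ v₂ : G.V}
    (hψ : G.IsPotential (G.toForm ψ) v₁ v₂) {β : ℝ} (hβ : 0 < β) :
    G.gffTwoPoint β v₁ v₂ =
      Complex.exp ((-(G.toForm ψ v₁ - G.toForm ψ v₂) / (2 * β) : ℝ)) := by
  have hpos : ∀ x, x ≠ 0 → 0 < G.dirichletForm x x := fun x hx => dirichletForm_pos hG hx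
  have hsymm : LinearMap.IsSymm G.dirichletForm := ⟨fun x y => by
    simp only [dirichletForm_apply, RingHom.id_apply]
    exact Finset.sum_congr rfl fun e _ => mul_comm _ _⟩
  obtain ⟨key, hne⟩ := integral_cexp_bilinForm G.dirichletForm hsymm hpos hβ ψ
  have hQ : ∀ x, ∑ e, G.d (G.toForm x) e ^ 2 = G.dirichletForm x x := fun x => by
    simp only [dirichletForm_apply, sq]
  have hcont : Continuous fun x => G.dirichletForm x x := by
    have h1 : Continuous G.toForm := G.toFormₗ.continuous_of_finiteDimensional
    have h2 : ∀ v, Continuous fun x => G.toForm x v := fun v => (continuous_apply v).comp h1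
    simp only [dirichletForm_apply, d]
    exact continuous_finsetSum _ fun e _ => (((h2 _).sub (h2 _)).mul ((h2 _).sub (h2 _)))
  have hexp : Continuous fun x : G.Coord => Real.exp (-(β / 2) * G.dirichletForm x x) := by
    fun_prop
  have hint : Integrable fun x : G.Coord => Real.exp (-(β / 2) * G.dirichletForm x x) := by
    -- Integrability follows from the non-vanishing of the integral, since the integral of a
    -- non-integrable function is `0` by convention.
    have : Integrable fun x : G.Coord =>
        Complex.exp ((-(β / 2) * G.dirichletForm x x : ℝ)) := by
      by_contra h
      exact hne (integral_undef h)
    simpa only [Complex.norm_exp_ofReal] using this.norm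
  have hB : ∀ x, G.dirichletForm ψ x = G.toForm x v₁ - G.toForm x v₂ := fun x => by
    rw [dirichletForm_apply, hψ]
  have hcast : ((∫ x : G.Coord, Real.exp (-(β / 2) * G.dirichletForm x x) : ℝ) : ℂ) =
      ∫ x : G.Coord, Complex.exp ((-(β / 2) * G.dirichletForm x x : ℝ)) := by
    rw [← integral_complex_ofReal]
    simp only [Complex.ofReal_exp]
  rw [gffTwoPoint, gff]
  simp only [hQ]
  rw [integral_normalize_withDensity hexp.measurable (fun x => (Real.exp_pos _).le) hint,
    Complex.real_smul, Complex.ofReal_inv, hcast, inv_mul_eq_iff_eq_mul₀ hne, mul_comm, ← hB ψ,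
    ← key]
  congr 1; funext x
  rw [Complex.real_smul, Complex.ofReal_exp, ← Complex.exp_add, hB x]
  congr 1
  push_cast
  ring

end RootedGraph

/-! ### Integer Gaussian sums -/

theorem summable_gauss {b : ℝ} (hb : 0 < b) (a : ℝ) :
    Summable fun m : ℤ => Real.exp (-(b / 2) * ((m : ℝ) - a) ^ 2) := by
  have hτ : 0 < (((b / (2 * Real.pi) : ℝ) : ℂ) * Complex.I).im := by
    simp only [Complex.mul_I_im, Complex.ofReal_re]
    positivity
  have h := ((summable_jacobiTheta₂_term_iff
    (((-(a * b) / (2 * Real.pi) : ℝ) : ℂ) * Complex.I) _).2 hτ).norm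
  refine (h.mul_left (Real.exp (-(b / 2) * a ^ 2))).congr fun m => ?_
  rw [norm_jacobiTheta₂_term, ← Real.exp_add]
  simp only [Complex.mul_I_im, Complex.ofReal_re]
  congr 1
  have := Real.pi_ne_zero
  field_simp
  ring

theorem tsum_int_eq_center_add {E : Type*} [NormedAddCommGroup E] [CompleteSpace E] {f : ℤ → E}
    (hf : Summable f) :
    ∑' m, f m = f 0 + f 1 + f (-1) + ∑' m : ℤ, (if m.natAbs ≤ 1 then 0 else f m) := by
  have hg : Summable fun m : ℤ => if m.natAbs ≤ 1 then f m else 0 :=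
    summable_of_hasFiniteSupport ((Set.finite_Icc (-1 : ℤ) 1).subset fun m hm => by
      simp only [Function.mem_support, ne_eq, ite_eq_right_iff, Classical.not_imp] at hm
      simp only [Set.mem_Icc]; omega)
  have hr : Summable fun m : ℤ => if m.natAbs ≤ 1 then 0 else f m := by
    refine (hf.sub hg).congr fun m => ?_
    split_ifs <;> simp
  have hs : ∑' m : ℤ, (if m.natAbs ≤ 1 then f m else 0) = f 0 + f 1 + f (-1) := by
    rw [tsum_eq_sum (s := {0, 1, -1})]
    · rw [Finset.sum_insert (by decide), Finset.sum_insert (by decide), Finset.sum_singleton]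
      simp [add_assoc]
    · intro m hm
      simp only [Finset.mem_insert, Finset.mem_singleton, not_or] at hm
      rw [if_neg]; omega
  rw [← hs, ← hg.tsum_add hr]
  refine tsum_congr fun m => ?_
  split_ifs <;> simp

theorem hasSum_half_pow_natAbs : HasSum (fun m : ℤ => (1 / 2 : ℝ) ^ m.natAbs) 3 := by
  have h1 : HasSum (fun n : ℕ => (1 / 2 : ℝ) ^ ((n : ℤ)).natAbs) 2 := by
    simpa using hasSum_geometric_two
  have h2 : HasSum (fun n : ℕ => (1 / 2 : ℝ) ^ (-((n : ℤ) + 1)).natAbs) 1 := by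
    have := hasSum_geometric_two.mul_left (1 / 2 : ℝ)
    rw [show (1 / 2 : ℝ) * 2 = 1 by norm_num] at this
    have e : (fun n : ℕ => (1 / 2 : ℝ) ^ (-((n : ℤ) + 1)).natAbs) =
        fun n => 1 / 2 * (1 / 2) ^ n := by
      funext n
      rw [show (-((n : ℤ) + 1)).natAbs = n + 1 by omega, pow_succ']
    rw [e]
    exact this
  have := HasSum.of_nat_of_neg_add_one (f := fun m : ℤ => (1 / 2 : ℝ) ^ m.natAbs) h1 h2
  norm_num at this ⊢
  exact this

theorem cast_natAbs_sq (m : ℤ) : (m.natAbs : ℝ) ^ 2 = (m : ℝ) ^ 2 := by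
  rw [Nat.cast_natAbs, Int.cast_abs, sq_abs]

/-- The factor `3` is the full sum of `(1/2) ^ |m|` over `ℤ`. -/
theorem tail_sum_le {f : ℤ → ℝ} (hf : Summable f) {c : ℝ} (hc : 0 ≤ c)
    (h : ∀ m : ℤ, 2 ≤ m.natAbs → f m ≤ c * (1 / 2) ^ m.natAbs) :
    ∑' m : ℤ, (if m.natAbs ≤ 1 then 0 else f m) ≤ 3 * c := by
  have hr : Summable fun m : ℤ => if m.natAbs ≤ 1 then 0 else f m := by
    refine (hf.indicator {m : ℤ | ¬ m.natAbs ≤ 1}).congr fun m => ?_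
    simp only [Set.indicator, Set.mem_ofPred_eq]
    split_ifs <;> simp_all
  have h3 := hasSum_half_pow_natAbs.mul_left c
  rw [mul_comm 3 c, ← h3.tsum_eq]
  refine hr.tsum_le_tsum (fun m => ?_) h3.summable
  split_ifs with hm
  · positivity
  · exact h m (by omega)

/-- Lower bound of a three point variance by the pair `{0, ±1}`. -/
theorem norm_three_point_le {s₁ s₂ : ℝ} (h₁ : 0 ≤ s₁) (h₂ : 0 ≤ s₂) (t : ℝ) :
    ‖(1 : ℂ) + s₁ * Complex.exp (Complex.I * t) + s₂ * Complex.exp (-(Complex.I * t))‖ ≤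
      1 + (s₁ + s₂) - (s₁ + s₂) * (1 - Real.cos t) / (1 + (s₁ + s₂)) := by
  have hc := Real.neg_one_le_cos t
  have hc1 := Real.cos_le_one t
  set S := s₁ + s₂ with hS
  have hS0 : 0 ≤ S := add_nonneg h₁ h₂
  have hnn : 0 ≤ 1 + S - S * (1 - Real.cos t) / (1 + S) := by
    rw [sub_nonneg, div_le_iff₀ (by linarith)]
    nlinarith
  refine abs_le_of_sq_le_sq' ?_ hnn |>.2
  have e : (1 : ℂ) + s₁ * Complex.exp (Complex.I * t) + s₂ * Complex.exp (-(Complex.I * t)) =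
      ⟨1 + S * Real.cos t, (s₁ - s₂) * Real.sin t⟩ := by
    have h1 : Complex.I * t = t * Complex.I := mul_comm _ _
    have h2 : -(Complex.I * t) = ((-t : ℝ) : ℂ) * Complex.I := by push_cast; ring
    rw [h2, h1, Complex.exp_mul_I, Complex.exp_mul_I]
    apply Complex.ext <;>
      simp [← Complex.ofReal_cos, ← Complex.ofReal_sin, hS] <;> ring
  rw [e, ← Complex.normSq_eq_norm_sq, Complex.normSq_mk]
  -- Replacing `(s₁ - s₂)²` by `S²` bounds the squared norm by `(1 + S)² - 2 S (1 - cos t)`. This is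
  -- the square of the right-hand side, up to dropping the square of the subtracted term.
  have hk : (S * (1 - Real.cos t) / (1 + S)) * (1 + S) = S * (1 - Real.cos t) := by
    field_simp
  have hsc := Real.sin_sq_add_cos_sq t
  have hd : (s₁ - s₂) ^ 2 ≤ S ^ 2 := by rw [hS]; nlinarith
  nlinarith [sq_nonneg (S * (1 - Real.cos t) / (1 + S)), mul_le_mul_of_nonneg_right hd (sq_nonneg (Real.sin t))]

/-- The threshold `13` lies just below `(2π)² / 3`, the least value of `b = (2π)² β` when `β ≥ 1/3`.
-/
theorem exp_neg_half_le {b : ℝ} (hb : 13 ≤ b) : Real.exp (-(b / 2)) ≤ 1 / 100 := by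
  have h1 : Real.exp (-(b / 2)) ≤ Real.exp (-6) := Real.exp_le_exp.2 (by linarith)
  have h2 : Real.exp (-6) = (Real.exp 1 ^ 6)⁻¹ := by
    rw [← Real.exp_nat_mul, ← Real.exp_neg]; norm_num
  have h3 : (100 : ℝ) ≤ Real.exp 1 ^ 6 := by
    have := Real.exp_one_gt_d9
    calc (100 : ℝ) ≤ (2.7 : ℝ) ^ 6 := by norm_num
      _ ≤ _ := pow_le_pow_left₀ (by norm_num) (by linarith) 6
  rw [h2] at h1
  refine h1.trans ?_
  rw [one_div]
  exact inv_anti₀ (by norm_num) h3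

theorem pow_tail_le {q : ℝ} (hq0 : 0 < q) (hq : q ≤ 1 / 100) {j : ℕ} (hj : 2 ≤ j) :
    q ^ j ≤ (4 * q ^ 2) * (1 / 2) ^ j := by
  obtain ⟨i, rfl⟩ := Nat.exists_eq_add_of_le hj
  have : q ^ i ≤ (1 / 2) ^ i := pow_le_pow_left₀ hq0.le (by linarith) i
  rw [pow_add, pow_add]
  nlinarith [sq_nonneg q]

theorem sq_mul_pow_tail_le {q : ℝ} (hq0 : 0 < q) (hq : q ≤ 1 / 100) {j : ℕ} (hj : 2 ≤ j) :
    (j : ℝ) ^ 2 * q ^ (j ^ 2) ≤ q ^ 2 * (1 / 2) ^ j := by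
  have h1 : (j : ℝ) ≤ 2 ^ j := by exact_mod_cast Nat.lt_two_pow_self.le
  have h2 : q ^ (j ^ 2) ≤ q ^ (2 + j) :=
    pow_le_pow_of_le_one hq0.le (by linarith) (by nlinarith)
  have h3 : (4 * q) ^ j ≤ (1 / 2) ^ j := pow_le_pow_left₀ (by positivity) (by linarith) j
  calc (j : ℝ) ^ 2 * q ^ (j ^ 2) ≤ (2 ^ j) ^ 2 * q ^ (2 + j) := by gcongr
    _ = q ^ 2 * (4 * q) ^ j := by
      rw [mul_pow, pow_add, ← pow_mul, mul_comm j 2, pow_mul]; norm_num; ring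
    _ ≤ _ := by gcongr

theorem varIG_nonneg (a b : ℝ) : 0 ≤ varIG a b := ProbabilityTheory.variance_nonneg _ _

theorem integerGaussian_integral {b : ℝ} (hb : 0 < b) (a : ℝ) (g : ℤ → ℝ) :
    ∫ k, g k ∂(integerGaussian a b) =
      (∑' m : ℤ, Real.exp (-(b / 2) * ((m : ℝ) - a) ^ 2))⁻¹ *
        ∫ m : ℤ, Real.exp (-(b / 2) * ((m : ℝ) - a) ^ 2) * g m ∂Measure.count := by
  have hi : Integrable (fun m : ℤ => Real.exp (-(b / 2) * ((m : ℝ) - a) ^ 2)) Measure.count :=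
    integrable_count_iff.2 (summable_gauss hb a).norm
  rw [integerGaussian, integral_normalize_withDensity (measurable_of_countable _)
    (fun _ => (Real.exp_pos _).le) hi, integral_countable hi]
  simp

/-- With `q = exp (-b/2)`, bound the variance by the second moment and the partition function from
below by `1`. The points `±1` contribute `2q`, and the tail at most `3q² ≤ 0.03 q`. -/
theorem varIG_zero_le {b : ℝ} (hb : 13 ≤ b) : varIG 0 b ≤ 2.03 * Real.exp (-(b / 2)) := by
  set q := Real.exp (-(b / 2)) with hqdef
  have hq0 : 0 < q := Real.exp_pos _
  have hq : q ≤ 1 / 100 := exp_neg_half_le hb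
  have hb0 : 0 < b := by linarith
  have hsum := summable_gauss hb0 0
  have hw : ∀ m : ℤ, Real.exp (-(b / 2) * ((m : ℝ) - 0) ^ 2) = q ^ (m.natAbs ^ 2) := fun m => by
    rw [hqdef, ← Real.exp_nat_mul]
    congr 1
    rw [Nat.cast_pow, cast_natAbs_sq]; ring
  have hZ1 : 1 ≤ ∑' m : ℤ, Real.exp (-(b / 2) * ((m : ℝ) - 0) ^ 2) := by
    have := hsum.le_tsum 0 (fun m _ => (Real.exp_pos _).le)
    simpa using this
  have hprob : IsProbabilityMeasure (integerGaussian 0 b) := by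
    have h := integerGaussian_integral hb0 0 fun _ => 1
    have hi : Integrable (fun m : ℤ => Real.exp (-(b / 2) * ((m : ℝ) - 0) ^ 2)) Measure.count :=
      integrable_count_iff.2 hsum.norm
    rw [isProbabilityMeasure_iff_real]
    simp only [mul_one, integral_countable hi, integral_const, smul_eq_mul] at h
    rw [h]
    simp only [measureReal_def, Measure.count_singleton, ENNReal.toReal_one, one_mul]
    exact inv_mul_cancel₀ (by linarith)
  have hsq : Summable fun m : ℤ => Real.exp (-(b / 2) * ((m : ℝ) - 0) ^ 2) * (m : ℝ) ^ 2 := by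
    have h3 := hasSum_half_pow_natAbs.summable.mul_left 4
    refine Summable.of_nonneg_of_le (fun m => by positivity) (fun m => ?_) h3
    rw [hw]
    have e := (cast_natAbs_sq m).symm
    rw [e]
    rcases Nat.lt_or_ge m.natAbs 2 with h | h
    · interval_cases m.natAbs <;> norm_num
      linarith
    · have := sq_mul_pow_tail_le hq0 hq h
      have h1 : q ^ 2 ≤ 4 := by nlinarith
      rw [mul_comm]
      exact this.trans (by gcongr)
  have h1 : varIG 0 b ≤ ∫ k, ((k : ℤ) : ℝ) ^ 2 ∂(integerGaussian 0 b) :=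
    ProbabilityTheory.variance_le_expectation_sq (measurable_of_countable _).aestronglyMeasurable
  rw [integerGaussian_integral hb0] at h1
  have hi : Integrable (fun m : ℤ => Real.exp (-(b / 2) * ((m : ℝ) - 0) ^ 2) * (m : ℝ) ^ 2)
      Measure.count := integrable_count_iff.2 hsq.norm
  rw [integral_countable hi] at h1
  simp only [measureReal_def, Measure.count_singleton, ENNReal.toReal_one, one_smul] at h1
  have h2 : ∑' m : ℤ, Real.exp (-(b / 2) * ((m : ℝ) - 0) ^ 2) * (m : ℝ) ^ 2 ≤ 2.03 * q := by
    rw [tsum_int_eq_center_add hsq]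
    have ht := tail_sum_le hsq (c := q ^ 2) (by positivity) (fun m hm => by
      have e := (cast_natAbs_sq m).symm
      rw [hw, e, mul_comm]
      exact sq_mul_pow_tail_le hq0 hq hm)
    simp only [hw] at ht ⊢
    norm_num at ht ⊢
    nlinarith
  have h4 : (∑' m : ℤ, Real.exp (-(b / 2) * ((m : ℝ) - 0) ^ 2))⁻¹ ≤ 1 := inv_le_one_of_one_le₀ hZ1
  have h5 : 0 ≤ ∑' m : ℤ, Real.exp (-(b / 2) * ((m : ℝ) - 0) ^ 2) * (m : ℝ) ^ 2 :=
    tsum_nonneg fun m => by positivity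
  nlinarith

theorem iInf_varIG_nonneg (b : ℝ) : 0 ≤ ⨅ a : Set.Icc (0 : ℝ) (1 / 2), varIG (a : ℝ) b :=
  Real.iInf_nonneg fun a => varIG_nonneg a b

/-- Testing the centre `0` suffices: the decay rate proved below for every centre already beats a
quarter of this bound, so no variance at another centre has to be computed. -/
theorem iInf_varIG_le {b : ℝ} (hb : 13 ≤ b) :
    ⨅ a : Set.Icc (0 : ℝ) (1 / 2), varIG (a : ℝ) b ≤ 2.03 * Real.exp (-(b / 2)) :=
  (ciInf_le ⟨0, by rintro _ ⟨a, rfl⟩; exact varIG_nonneg a b⟩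
    (⟨0, by norm_num⟩ : Set.Icc (0 : ℝ) (1 / 2))).trans (varIG_zero_le hb)

/-- The numerical margin: `2.03 · 1.0012 / (4 · 1.2)` is about `0.42`, below `0.49`. The loss of a
factor `2` against the Gaussian rate `t² / 2` is what makes room for centres other than `0`. -/
theorem three_point_rate {q S Z t c : ℝ} (hq : 0 ≤ q) (hS : 0 ≤ S)
    (hSS : 1.2 * q * (1 + S) ^ 2 ≤ S) (hZ : Z ≤ 1.0012 * (1 + S)) (hc : 0.49 * t ^ 2 ≤ 1 - c) :
    2.03 * q * t ^ 2 / 4 * Z ≤ S * (1 - c) / (1 + S) := by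
  have hS0 : 0 < 1 + S := by linarith
  rw [le_div_iff₀ hS0]
  calc 2.03 * q * t ^ 2 / 4 * Z * (1 + S)
      ≤ 2.03 * q * t ^ 2 / 4 * (1.0012 * (1 + S)) * (1 + S) := by gcongr
    _ = (2.03 * 1.0012 / 4 / 1.2) * t ^ 2 * (1.2 * q * (1 + S) ^ 2) := by ring
    _ ≤ (2.03 * 1.0012 / 4 / 1.2) * t ^ 2 * S :=
      mul_le_mul_of_nonneg_left hSS (by positivity)
    _ ≤ 0.49 * t ^ 2 * S := by gcongr; norm_num
    _ = S * (0.49 * t ^ 2) := mul_comm _ _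
    _ ≤ S * (1 - c) := mul_le_mul_of_nonneg_left hc hS

/-- The factor of the integer Gaussian sum with frequency `t`, for a centre in `[0, 1/2]`. -/
theorem norm_gaussSum_le_of_mem {b : ℝ} (hb : 13 ≤ b) {a : ℝ} (ha : a ∈ Set.Icc (0 : ℝ) (1 / 2))
    {t : ℝ} (ht : |t| ≤ 0.4) :
    ‖∑' m : ℤ, ((Real.exp (-(b / 2) * ((m : ℝ) - a) ^ 2) : ℝ) : ℂ) *
        Complex.exp (Complex.I * (t * m : ℝ))‖ ≤
      Real.exp (-(2.03 * Real.exp (-(b / 2))) * t ^ 2 / 4) *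
        ∑' m : ℤ, Real.exp (-(b / 2) * ((m : ℝ) - a) ^ 2) := by
  set q := Real.exp (-(b / 2)) with hqdef
  have hq0 : 0 < q := Real.exp_pos _
  have hq : q ≤ 1 / 100 := exp_neg_half_le hb
  have hb0 : 0 < b := by linarith
  obtain ⟨ha0, ha1⟩ := ha
  set w : ℤ → ℝ := fun m => Real.exp (-(b / 2) * ((m : ℝ) ^ 2 - 2 * a * m)) with hwdef
  set κ := Real.exp (-(b / 2) * a ^ 2) with hκ
  have hκ0 : 0 < κ := Real.exp_pos _
  have hwκ : ∀ m : ℤ, Real.exp (-(b / 2) * ((m : ℝ) - a) ^ 2) = κ * w m := fun m => by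
    rw [hκ, hwdef, ← Real.exp_add]; congr 1; ring
  have hwpos : ∀ m, 0 < w m := fun m => Real.exp_pos _
  have hws : Summable w := by
    refine ((summable_gauss hb0 a).mul_left κ⁻¹).congr fun m => ?_
    rw [hwκ, inv_mul_cancel_left₀ hκ0.ne']
  set z : ℤ → ℂ := fun m => (w m : ℂ) * Complex.exp (Complex.I * (t * m : ℝ)) with hzdef
  have hzn : ∀ m, ‖z m‖ = w m := fun m => by
    rw [hzdef]
    simp only [norm_mul, Complex.norm_real, Real.norm_eq_abs, abs_of_pos (hwpos m)]
    rw [mul_comm Complex.I, Complex.norm_exp_ofReal_mul_I, mul_one]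
  have hzs : Summable z := Summable.of_norm (by simpa only [hzn] using hws)
  have e1 : ∀ m : ℤ, ((Real.exp (-(b / 2) * ((m : ℝ) - a) ^ 2) : ℝ) : ℂ) *
      Complex.exp (Complex.I * (t * m : ℝ)) = (κ : ℂ) * z m := fun m => by
    rw [hwκ, hzdef]; push_cast; ring
  simp only [e1]
  simp only [hwκ]
  rw [tsum_mul_left, tsum_mul_left, norm_mul, Complex.norm_real, Real.norm_eq_abs, abs_of_pos hκ0,
    mul_left_comm]
  refine mul_le_mul_of_nonneg_left ?_ hκ0.le
  rw [tsum_int_eq_center_add hzs, tsum_int_eq_center_add hws]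
  set T := ∑' m : ℤ, (if m.natAbs ≤ 1 then 0 else w m) with hT
  have hrs : Summable fun m : ℤ => if m.natAbs ≤ 1 then 0 else w m := by
    refine (hws.indicator {m : ℤ | ¬ m.natAbs ≤ 1}).congr fun m => ?_
    simp only [Set.indicator, Set.mem_ofPred_eq]
    split_ifs <;> simp_all
  have hTz : ‖∑' m : ℤ, (if m.natAbs ≤ 1 then 0 else z m)‖ ≤ T := by
    refine tsum_of_norm_bounded hrs.hasSum fun m => ?_
    split_ifs
    · simp
    · rw [hzn]
  have hT0 : 0 ≤ T := tsum_nonneg fun m => by split_ifs; exacts [le_rfl, (hwpos m).le]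
  have hTq : T ≤ 3 * (4 * q ^ 2) := by
    refine tail_sum_le hws (by positivity) fun m hm => le_trans ?_ (pow_tail_le hq0 hq hm)
    rw [hwdef, hqdef, ← Real.exp_nat_mul]
    refine Real.exp_le_exp.2 ?_
    have e := (cast_natAbs_sq m).symm
    have e2 : (m : ℝ) ≤ m.natAbs := by
      rw [Nat.cast_natAbs, Int.cast_abs]
      exact le_abs_self _
    have hj : (2 : ℝ) ≤ m.natAbs := by exact_mod_cast hm
    have : (m.natAbs : ℝ) ≤ (m : ℝ) ^ 2 - 2 * a * m := by
      rw [e]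
      nlinarith [mul_le_mul_of_nonneg_left e2 ha0]
    nlinarith
  have hw0 : w 0 = 1 := by simp [hwdef]
  -- The product `w 1 * w (-1) = q²` does not depend on the centre, so AM-GM gives `S ≥ 2q`: moving
  -- the centre cannot reduce the mass at `±1` relative to that at `0`. The condition `a ≤ 1/2`
  -- gives `w 1 ≤ 1` and so keeps `S` bounded.
  set S := w 1 + w (-1) with hS
  have hw11 : w 1 * w (-1) = q ^ 2 := by
    rw [hwdef, hqdef]
    simp only []
    rw [← Real.exp_add, ← Real.exp_nat_mul]
    congr 1; push_cast; ring
  have hw1 : w 1 ≤ 1 := by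
    rw [hwdef]
    refine Real.exp_le_one_iff.2 ?_
    push_cast
    nlinarith
  have hwm1 : w (-1) ≤ q := by
    rw [hwdef, hqdef]
    refine Real.exp_le_exp.2 ?_
    push_cast
    nlinarith
  have hSq : 2 * q ≤ S := by
    have h1 := (hwpos 1).le
    have h2 := (hwpos (-1)).le
    refine abs_le_of_sq_le_sq' ?_ (by positivity) |>.2
    rw [hS]
    nlinarith [sq_nonneg (w 1 - w (-1))]
  have hS1 : S ≤ 1.01 := by rw [hS]; linarith
  have h3 := norm_three_point_le (hwpos 1).le (hwpos (-1)).le t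
  rw [← hS] at h3
  have hz3 : z 0 + z 1 + z (-1) = (1 : ℂ) + (w 1 : ℂ) * Complex.exp (Complex.I * t) +
      (w (-1) : ℂ) * Complex.exp (-(Complex.I * t)) := by
    simp [hzdef, hw0]
  rw [hz3, hw0]
  have hcos : 0.49 * t ^ 2 ≤ 1 - Real.cos t := by
    have h := Real.cos_bound (x := t) (ht.trans (by norm_num))
    have h4 : |t| ^ 4 = t ^ 2 * t ^ 2 := by
      rw [← sq_abs t]; ring
    have h5 : t ^ 2 ≤ 0.16 := by rw [← sq_abs t]; nlinarith [abs_nonneg t]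
    rw [h4] at h
    have := (abs_le.1 h).2
    nlinarith [sq_nonneg t]
  -- The difference of the two sides is concave in `S`, so the endpoints of `[2q, 1.01]` decide.
  have hSS : 1.2 * q * (1 + S) ^ 2 ≤ S := by
    nlinarith [mul_nonneg (sub_nonneg.2 hSq) (sub_nonneg.2 hS1), mul_pos hq0 hq0]
  set Z := 1 + S + T with hZ
  have hZS : Z ≤ 1.0012 * (1 + S) := by
    rw [hZ]; nlinarith
  have hmain : ‖(1 : ℂ) + (w 1 : ℂ) * Complex.exp (Complex.I * t) +
      (w (-1) : ℂ) * Complex.exp (-(Complex.I * t)) +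
        ∑' m : ℤ, (if m.natAbs ≤ 1 then 0 else z m)‖ ≤
      Z - S * (1 - Real.cos t) / (1 + S) := by
    refine (norm_add_le _ _).trans ?_
    rw [hZ]
    linarith
  have hZe : 1 + w 1 + w (-1) + T = Z := by rw [hZ, hS]; ring
  rw [hZe]
  refine hmain.trans ?_
  have hexp := Real.add_one_le_exp (-(2.03 * q) * t ^ 2 / 4)
  have hZ0 : 0 < Z := by rw [hZ]; linarith
  refine le_trans ?_ (mul_le_mul_of_nonneg_right hexp hZ0.le)
  have hk := three_point_rate hq0.le (by linarith) hSS hZS hcos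
  linarith

theorem norm_gaussSum_le_tsum {b : ℝ} (hb : 0 < b) (a t : ℝ) :
    ‖∑' m : ℤ, ((Real.exp (-(b / 2) * ((m : ℝ) - a) ^ 2) : ℝ) : ℂ) *
        Complex.exp (Complex.I * (t * m : ℝ))‖ ≤
      ∑' m : ℤ, Real.exp (-(b / 2) * ((m : ℝ) - a) ^ 2) := by
  refine tsum_of_norm_bounded (summable_gauss hb a).hasSum fun m => ?_
  rw [norm_mul, mul_comm Complex.I, Complex.norm_exp_ofReal_mul_I, mul_one, Complex.norm_real,
    Real.norm_eq_abs, abs_of_pos (Real.exp_pos _)]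

/-- Translating the summation index by an integer only introduces a phase, and `m ↦ -m` reverses the
signs of the centre and of `t`. Hence every centre reduces to `[0, 1/2]`. -/
theorem norm_gaussSum_le {b : ℝ} (hb : 13 ≤ b) (a : ℝ) {t : ℝ} (ht : |t| ≤ 0.4) :
    ‖∑' m : ℤ, ((Real.exp (-(b / 2) * ((m : ℝ) - a) ^ 2) : ℝ) : ℂ) *
        Complex.exp (Complex.I * (t * m : ℝ))‖ ≤
      Real.exp (-(⨅ a : Set.Icc (0 : ℝ) (1 / 2), varIG (a : ℝ) b) * t ^ 2 / 4) *
        ∑' m : ℤ, Real.exp (-(b / 2) * ((m : ℝ) - a) ^ 2) := by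
  have hv := iInf_varIG_le hb
  suffices h : ‖∑' m : ℤ, ((Real.exp (-(b / 2) * ((m : ℝ) - a) ^ 2) : ℝ) : ℂ) *
        Complex.exp (Complex.I * (t * m : ℝ))‖ ≤
      Real.exp (-(2.03 * Real.exp (-(b / 2))) * t ^ 2 / 4) *
        ∑' m : ℤ, Real.exp (-(b / 2) * ((m : ℝ) - a) ^ 2) by
    refine h.trans (mul_le_mul_of_nonneg_right (Real.exp_le_exp.2 ?_)
      (tsum_nonneg fun m => (Real.exp_pos _).le))
    nlinarith [sq_nonneg t]
  obtain ⟨k, hk⟩ : ∃ k : ℤ, |a - k| ≤ 1 / 2 := ⟨round a, abs_sub_round a⟩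
  have hshift : ∀ f : ℤ → ℝ, ∑' m : ℤ, f m = ∑' m : ℤ, f (m + k) := fun f =>
    ((Equiv.addRight k).tsum_eq f).symm
  have hshiftC : ∀ f : ℤ → ℂ, ∑' m : ℤ, f m = ∑' m : ℤ, f (m + k) := fun f =>
    ((Equiv.addRight k).tsum_eq f).symm
  rw [hshift, hshiftC]
  have e1 : ∀ m : ℤ, (((m + k : ℤ) : ℝ) - a) ^ 2 = ((m : ℝ) - (a - k)) ^ 2 := fun m => by
    push_cast; ring
  have e2 : ∀ m : ℤ, Complex.exp (Complex.I * (t * (m + k : ℤ) : ℝ)) =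
      Complex.exp (Complex.I * (t * k : ℝ)) * Complex.exp (Complex.I * (t * m : ℝ)) := fun m => by
    rw [← Complex.exp_add]; congr 1; push_cast; ring
  simp only [e1, e2, mul_left_comm _ (Complex.exp (Complex.I * (t * k : ℝ)))]
  rw [tsum_mul_left, norm_mul, mul_comm Complex.I, Complex.norm_exp_ofReal_mul_I, one_mul]
  set c := a - k with hc
  rcases le_total 0 c with h0 | h0
  · exact norm_gaussSum_le_of_mem hb ⟨h0, (abs_le.1 hk).2⟩ ht
  · have h := norm_gaussSum_le_of_mem hb (a := -c) ⟨by linarith, by linarith [(abs_le.1 hk).1]⟩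
      (t := -t) (by rwa [abs_neg])
    have hn : ∀ f : ℤ → ℝ, ∑' m : ℤ, f m = ∑' m : ℤ, f (-m) := fun f =>
      ((Equiv.neg ℤ).tsum_eq f).symm
    have hnC : ∀ f : ℤ → ℂ, ∑' m : ℤ, f m = ∑' m : ℤ, f (-m) := fun f =>
      ((Equiv.neg ℤ).tsum_eq f).symm
    rw [hn, hnC]
    have e3 : ∀ m : ℤ, (((-m : ℤ) : ℝ) - c) ^ 2 = ((m : ℝ) - (-c)) ^ 2 := fun m => by
      push_cast; ring
    have e4 : ∀ m : ℤ, t * ((-m : ℤ) : ℝ) = -t * m := fun m => by push_cast; ring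
    simp only [e3, e4]
    rwa [neg_sq t] at h

/-! ### Contour shifts on the torus -/

theorem isAddFundamentalDomain_box {ι : Type*} [Fintype ι] {T : ℝ} (hT : 0 < T) :
    ∃ L : AddSubgroup (ι → ℝ), Countable L ∧ (∀ g ∈ L, ∃ k : ι → ℤ, g = fun i => T * k i) ∧
      IsAddFundamentalDomain L (Set.univ.pi fun _ : ι => Set.Ico (0 : ℝ) T) volume := by
  classical
  set b := (Pi.basisFun ℝ ι).isUnitSMul (w := fun _ => T) (fun _ => hT.ne'.isUnit) with hb
  have hrepr : ∀ x i, b.repr x i = T⁻¹ * x i := fun x i => by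
    rw [hb, Module.Basis.repr_isUnitSMul, Pi.basisFun_repr]
    simp [Units.smul_def, IsUnit.unit]
  have hbox : ZSpan.fundamentalDomain b = Set.univ.pi fun _ : ι => Set.Ico (0 : ℝ) T := by
    ext x
    simp only [ZSpan.mem_fundamentalDomain, hrepr, Set.mem_Ico, Set.mem_pi, Set.mem_univ,
      forall_true_left]
    refine forall_congr' fun i => ?_
    rw [inv_mul_lt_iff₀ hT, mul_one, mul_nonneg_iff_of_pos_left (inv_pos.2 hT)]
  refine ⟨(Submodule.span ℤ (Set.range b)).toAddSubgroup, ?_, fun g hg => ?_, ?_⟩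
  · exact inferInstanceAs (Countable (Submodule.span ℤ (Set.range b)))
  · have h := (b.mem_span_iff_repr_mem ℤ g).1 hg
    choose k hk using h
    refine ⟨k, funext fun i => ?_⟩
    have := hk i
    rw [hrepr] at this
    have h2 : (k i : ℝ) = T⁻¹ * g i := by simpa using this
    rw [h2, mul_inv_cancel_left₀ hT.ne']
  · rw [← hbox]
    exact ZSpan.isAddFundamentalDomain b volume

open scoped Pointwise in
/-- The integral of a periodic function over a period cell is translation invariant. -/
theorem setIntegral_box_add {ι : Type*} [Fintype ι] {T : ℝ} (hT : 0 < T) {f : (ι → ℝ) → ℂ}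
    (hf : ∀ (x : ι → ℝ) (k : ι → ℤ), f (fun i => x i + T * k i) = f x) (s : ι → ℝ) :
    ∫ x in Set.univ.pi fun _ : ι => Set.Ico (0 : ℝ) T, f (s + x) =
      ∫ x in Set.univ.pi fun _ : ι => Set.Ico (0 : ℝ) T, f x := by
  obtain ⟨L, hc, hL, hfd⟩ := isAddFundamentalDomain_box (ι := ι) hT
  have hfd' := hfd.vadd_of_comm s
  have h1 := hfd.setIntegral_eq hfd' (f := f) fun g x => by
    obtain ⟨k, hk⟩ := hL g g.2
    have : g +ᵥ x = fun i => x i + T * k i := by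
      rw [AddSubgroup.vadd_def, hk]
      funext i
      simp [add_comm]
    rw [this, hf]
  rw [h1]
  have hmp := measurePreserving_add_left (volume : Measure (ι → ℝ)) s
  have hemb := (Homeomorph.addLeft s).measurableEmbedding
  have := hmp.setIntegral_preimage_emb hemb f (s +ᵥ Set.univ.pi fun _ : ι => Set.Ico (0 : ℝ) T)
  rw [← this]
  congr 2
  ext x
  simp [Set.mem_vadd_set]

/-- Shifting the domain of integration of a periodic holomorphic function in an imaginary
direction. -/
theorem setIntegral_box_shift {ι : Type*} [Fintype ι] {T : ℝ} (hT : 0 < T) {P : (ι → ℂ) → ℂ}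
    (hP : ContDiff ℂ 1 P)
    (hper : ∀ (x : ι → ℂ) (k : ι → ℤ), P (fun i => x i + ((T * k i : ℝ) : ℂ)) = P x) (η : ι → ℝ) :
    ∫ x in Set.univ.pi fun _ : ι => Set.Ico (0 : ℝ) T,
        P (fun i => (x i : ℂ) + Complex.I * (η i : ℂ)) =
      ∫ x in Set.univ.pi fun _ : ι => Set.Ico (0 : ℝ) T, P (fun i => (x i : ℂ)) := by
  set B : Set (ι → ℝ) := Set.univ.pi fun _ : ι => Set.Ico (0 : ℝ) T with hB
  have hBf : volume B < ⊤ := by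
    rw [hB, volume_pi_pi]
    exact ENNReal.prod_lt_top fun i _ => by simp
  have hBK : B ⊆ Set.univ.pi fun _ : ι => Set.Icc (0 : ℝ) T :=
    Set.pi_mono fun _ _ => Set.Ico_subset_Icc_self
  have hKc : IsCompact (Set.univ.pi fun _ : ι => Set.Icc (0 : ℝ) T) :=
    isCompact_univ_pi fun _ => isCompact_Icc
  have hBm : MeasurableSet B := MeasurableSet.univ_pi fun _ => measurableSet_Ico
  set η' : ι → ℂ := fun i => (η i : ℂ) with hη'
  set A : ℂ → (ι → ℝ) → (ι → ℂ) := fun t x i => (x i : ℂ) + t * (η i : ℂ) with hA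
  set H : ℂ → ℂ := fun t => ∫ x in B, P (A t x) with hH
  set H' : ℂ → ℂ := fun t => ∫ x in B, fderiv ℂ P (A t x) η' with hH'
  have hAc : Continuous fun p : ℂ × (ι → ℝ) => A p.1 p.2 := by
    simp only [hA]; fun_prop
  have hAct : ∀ t, Continuous (A t) := fun t => by simp only [hA]; fun_prop
  have hfd : Continuous fun z => fderiv ℂ P z η' :=
    (hP.continuous_fderiv (by norm_num)).clm_apply continuous_const
  have hderiv : ∀ t, HasDerivAt H (H' t) t := by
    intro t
    have hcomp : IsCompact ((Metric.closedBall t 1) ×ˢ Set.univ.pi fun _ : ι => Set.Icc (0 : ℝ) T) :=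
      (isCompact_closedBall t 1).prod hKc
    obtain ⟨C, hC⟩ := hcomp.exists_bound_of_continuousOn
      (f := fun p : ℂ × (ι → ℝ) => fderiv ℂ P (A p.1 p.2) η') (hfd.comp hAc).continuousOn
    obtain ⟨C', hC'⟩ := hKc.exists_bound_of_continuousOn
      (f := fun x => P (A t x)) (hP.continuous.comp (hAct t)).continuousOn
    refine (hasDerivAt_integral_of_dominated_loc_of_deriv_le (μ := volume.restrict B)
      (F := fun t x => P (A t x)) (F' := fun t x => fderiv ℂ P (A t x) η') (bound := fun _ => C)
      (Metric.closedBall_mem_nhds t one_pos) ?_ ?_ ?_ ?_ ?_ ?_).2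
    · exact Filter.Eventually.of_forall fun t =>
        (hP.continuous.comp (hAct t)).aestronglyMeasurable
    · refine Measure.integrableOn_of_bounded (M := C') hBf.ne
        (hP.continuous.comp (hAct t)).aestronglyMeasurable ?_
      exact (ae_restrict_iff' hBm).2 (ae_of_all _ fun x hx => hC' x (hBK hx))
    · exact (hfd.comp (hAct t)).aestronglyMeasurable
    · exact (ae_restrict_iff' hBm).2 (ae_of_all _ fun x hx s hs => hC (s, x) ⟨hs, hBK hx⟩)
    · exact integrableOn_const hBf.ne
    · refine ae_of_all _ fun x s _ => ?_
      have h1 : HasDerivAt (fun s => A s x) η' s := by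
        rw [hasDerivAt_pi]
        intro i
        have h0 := ((hasDerivAt_id s).mul_const (η i : ℂ)).const_add (x i : ℂ)
        rw [one_mul] at h0
        exact h0
      exact ((hP.differentiable (by norm_num)) (A s x)).hasFDerivAt.comp_hasDerivAt s h1
  have hinv : ∀ (t : ℂ) (s : ℝ), H (t + s) = H t := by
    intro t s
    have h := setIntegral_box_add hT (f := fun x => P (A t x)) (fun x k => by
      rw [← hper (A t x) k]
      congr 1; funext i
      simp only [hA]; push_cast; ring) (fun i => s * η i)
    simp only [hH]
    rw [hB, ← h]
    congr 1; funext x; congr 1; funext i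
    simp only [hA, Pi.add_apply]; push_cast; ring
  -- A real change of `t` translates a periodic integrand, so `H` is constant along real directions.
  -- Its complex derivative therefore vanishes everywhere, and `H` takes the same value at
  -- `Complex.I` and at `0`; no explicit contour is needed.
  have hzero : ∀ t, H' t = 0 := by
    intro t
    have h1 : HasDerivAt (fun s : ℝ => H (t + s)) (H' t) 0 := by
      have h2 : HasDerivAt (fun s : ℂ => H (t + s)) (H' t) ((0 : ℝ) : ℂ) := by
        have := hderiv (t + ((0 : ℝ) : ℂ))
        have h3 := this.comp_const_add t ((0 : ℝ) : ℂ)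
        simpa using h3
      exact h2.comp_ofReal
    simp only [hinv] at h1
    exact h1.unique (hasDerivAt_const _ _)
  have hconst := is_const_of_deriv_eq_zero (f := H) (fun t => (hderiv t).differentiableAt)
    (fun t => by rw [(hderiv t).deriv, hzero])
  have := hconst Complex.I 0
  simpa [hH, hA] using this

/-! ### The Villain weight as a holomorphic function -/

/-- The Villain edge weight, extended to complex angles. -/
noncomputable def theta (β : ℝ) (z : ℂ) : ℂ :=
  ∑' m : ℤ, Complex.exp (-(β / 2) * (z + 2 * Real.pi * m) ^ 2)

/-- The Villain edge weight. -/
noncomputable def thetaReal (β x : ℝ) : ℝ :=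
  ∑' m : ℤ, Real.exp (-(β / 2) * (x + 2 * Real.pi * (m : ℝ)) ^ 2)

theorem theta_ofReal (β x : ℝ) : theta β x = thetaReal β x := by
  rw [theta, thetaReal, Complex.ofReal_tsum]
  refine tsum_congr fun m => ?_
  push_cast
  rfl

/-- Expanding the square exhibits the edge weight as a Jacobi theta function, from which it inherits
holomorphy. -/
theorem theta_eq_jacobiTheta₂ (β : ℝ) (z : ℂ) :
    theta β z = Complex.exp (-(β / 2) * z ^ 2) *
      jacobiTheta₂ (Complex.I * β * z) (2 * Real.pi * β * Complex.I) := by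
  rw [theta, jacobiTheta₂, ← tsum_mul_left]
  refine tsum_congr fun m => ?_
  rw [jacobiTheta₂_term, ← Complex.exp_add]
  congr 1
  linear_combination (-2 * (Real.pi : ℂ) * m * β * z - 2 * (Real.pi : ℂ) ^ 2 * m ^ 2 * β) *
    Complex.I_sq

theorem differentiable_theta {β : ℝ} (hβ : 0 < β) : Differentiable ℂ (theta β) := by
  have h : theta β = fun z => Complex.exp (-(β / 2) * z ^ 2) *
      jacobiTheta₂ (Complex.I * β * z) (2 * Real.pi * β * Complex.I) :=
    funext fun z => theta_eq_jacobiTheta₂ β z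
  rw [h]
  intro z
  have hτ : 0 < (2 * Real.pi * β * Complex.I : ℂ).im := by
    have : (2 * Real.pi * β * Complex.I : ℂ) = ((2 * Real.pi * β : ℝ) : ℂ) * Complex.I := by
      push_cast; ring
    rw [this, Complex.mul_I_im, Complex.ofReal_re]
    have := Real.pi_pos
    positivity
  have h1 := differentiableAt_jacobiTheta₂_fst (Complex.I * β * z) hτ
  have h2 : DifferentiableAt ℂ (fun z : ℂ => Complex.I * β * z) z := by fun_prop
  have h3 : DifferentiableAt ℂ
      (fun z => jacobiTheta₂ (Complex.I * β * z) (2 * Real.pi * β * Complex.I)) z :=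
    DifferentiableAt.comp (𝕜 := ℂ) z h1 h2
  exact DifferentiableAt.mul (by fun_prop) h3

theorem theta_add_period (β : ℝ) (z : ℂ) (k : ℤ) :
    theta β (z + 2 * Real.pi * k) = theta β z := by
  rw [theta, theta, ← (Equiv.addRight k).tsum_eq
    (fun m : ℤ => Complex.exp (-(β / 2) * (z + 2 * Real.pi * m) ^ 2))]
  refine tsum_congr fun m => ?_
  simp only [Equiv.coe_addRight]
  congr 2
  push_cast; ring

theorem thetaReal_eq (β x : ℝ) :
    thetaReal β x = ∑' m : ℤ, Real.exp (-((2 * Real.pi) ^ 2 * β / 2) *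
      ((m : ℝ) - -x / (2 * Real.pi)) ^ 2) := by
  refine tsum_congr fun m => ?_
  congr 1
  have := Real.pi_ne_zero
  field_simp
  ring

theorem thetaReal_pos {β : ℝ} (hβ : 0 < β) (x : ℝ) : 0 < thetaReal β x := by
  rw [thetaReal_eq]
  have hb : 0 < (2 * Real.pi) ^ 2 * β := by have := Real.pi_pos; positivity
  exact (summable_gauss hb _).tsum_pos (fun _ => (Real.exp_pos _).le) 0 (Real.exp_pos _)

/-- Expanding `(x + iy + 2πm)²` separates the modulus factor `exp (β y² / 2)`, a phase independent
of `m`, and a phase linear in `m`. What remains is the unnormalised characteristic function of an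
integer Gaussian. -/
theorem norm_theta_eq (β x y : ℝ) :
    ‖theta β (x + Complex.I * y)‖ = Real.exp (β * y ^ 2 / 2) *
      ‖∑' m : ℤ, ((Real.exp (-((2 * Real.pi) ^ 2 * β / 2) *
        ((m : ℝ) - -x / (2 * Real.pi)) ^ 2) : ℝ) : ℂ) *
          Complex.exp (Complex.I * (-(2 * Real.pi * β * y) * m : ℝ))‖ := by
  have h : theta β (x + Complex.I * y) =
      Complex.exp ((β * y ^ 2 / 2 : ℝ) + ((-(β * x * y) : ℝ) : ℂ) * Complex.I) *
      ∑' m : ℤ, ((Real.exp (-((2 * Real.pi) ^ 2 * β / 2) *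
        ((m : ℝ) - -x / (2 * Real.pi)) ^ 2) : ℝ) : ℂ) *
          Complex.exp (Complex.I * (-(2 * Real.pi * β * y) * m : ℝ)) := by
    rw [theta, ← tsum_mul_left]
    refine tsum_congr fun m => ?_
    rw [Complex.ofReal_exp, ← Complex.exp_add, ← Complex.exp_add]
    congr 1
    have : (Real.pi : ℂ) ≠ 0 := by exact_mod_cast Real.pi_ne_zero
    push_cast
    field_simp
    linear_combination (-(β : ℂ) * y ^ 2) * Complex.I_sq
  rw [h, norm_mul, Complex.exp_add, norm_mul, Complex.norm_exp_ofReal_mul_I,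
    Complex.norm_exp_ofReal, mul_one]

theorem norm_theta_le {β : ℝ} (hβ : 0 < β) (x y : ℝ) :
    ‖theta β (x + Complex.I * y)‖ ≤ Real.exp (β * y ^ 2 / 2) * thetaReal β x := by
  rw [norm_theta_eq, thetaReal_eq]
  have hb : 0 < (2 * Real.pi) ^ 2 * β := by have := Real.pi_pos; positivity
  exact mul_le_mul_of_nonneg_left (norm_gaussSum_le_tsum hb _ _) (Real.exp_pos _).le

theorem norm_theta_le_of_small {β : ℝ} (hβ : 1 / 3 ≤ β) (x : ℝ) {y : ℝ}
    (hy : |2 * Real.pi * β * y| ≤ 0.4) :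
    ‖theta β (x + Complex.I * y)‖ ≤ Real.exp (β * y ^ 2 / 2 -
      (⨅ a : Set.Icc (0 : ℝ) (1 / 2), varIG (a : ℝ) ((2 * Real.pi) ^ 2 * β)) *
        (2 * Real.pi * β * y) ^ 2 / 4) * thetaReal β x := by
  have hb : 13 ≤ (2 * Real.pi) ^ 2 * β := by
    have := Real.pi_gt_d2
    nlinarith [mul_pos Real.pi_pos Real.pi_pos]
  have h := norm_gaussSum_le hb (-x / (2 * Real.pi)) (t := -(2 * Real.pi * β * y)) (by rwa [abs_neg])
  rw [norm_theta_eq, thetaReal_eq, sub_eq_add_neg, Real.exp_add, mul_assoc (Real.exp _)]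
  refine mul_le_mul_of_nonneg_left (h.trans_eq ?_) (Real.exp_pos _).le
  rw [neg_sq, neg_mul, neg_div]

/-! ### The Villain two-point function after an imaginary shift. -/

namespace RootedGraph

variable (G : RootedGraph)

/-- Extension by `0` at the root of complex coordinates. -/
def toFormC (z : {v : G.V // v ≠ G.root} → ℂ) (v : G.V) : ℂ :=
  if h : v = G.root then 0 else z ⟨v, h⟩

/-- The integrand `exp (i (θ(v₁) - θ(v₂)))` times the Villain weight, for complex angles. -/
noncomputable def villainIntegrand (β : ℝ) (v₁ v₂ : G.V)
    (z : {v : G.V // v ≠ G.root} → ℂ) : ℂ :=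
  Complex.exp (Complex.I * (G.toFormC z v₁ - G.toFormC z v₂)) *
    ∏ e, theta β (G.toFormC z (G.tgt e) - G.toFormC z (G.src e))

variable {G}

theorem toFormC_ofReal (x : G.Coord) (v : G.V) :
    G.toFormC (fun i => (x i : ℂ)) v = G.toForm x v := by
  by_cases h : v = G.root <;> simp [toFormC, toForm, h]

theorem toFormC_shift (x y : G.Coord) (v : G.V) :
    G.toFormC (fun i => (x i : ℂ) + Complex.I * (y i : ℂ)) v =
      G.toForm x v + Complex.I * G.toForm y v := by
  by_cases h : v = G.root <;> simp [toFormC, toForm, h]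

theorem villainWeight_eq (β : ℝ) (w : G.V → ℝ) :
    G.villainWeight β w = ∏ e, thetaReal β (G.d w e) := rfl

theorem contDiff_villainIntegrand {β : ℝ} (hβ : 0 < β) (v₁ v₂ : G.V) :
    ContDiff ℂ 1 (G.villainIntegrand β v₁ v₂) := by
  have h : ∀ v, ContDiff ℂ 1 fun z => G.toFormC z v := fun v => by
    by_cases h : v = G.root
    · simpa [toFormC, h] using contDiff_const
    · simpa [toFormC, h] using contDiff_apply ℂ ℂ (⟨v, h⟩ : {v : G.V // v ≠ G.root})
  have hθ : ContDiff ℂ 1 (theta β) := (differentiable_theta hβ).contDiff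
  exact (contDiff_const.mul ((h _).sub (h _))).cexp.mul
    (contDiff_prod fun e _ => hθ.comp ((h _).sub (h _)))

theorem villainIntegrand_periodic (β : ℝ) (v₁ v₂ : G.V) (x : {v : G.V // v ≠ G.root} → ℂ)
    (k : {v : G.V // v ≠ G.root} → ℤ) :
    G.villainIntegrand β v₁ v₂ (fun i => x i + ((2 * Real.pi * k i : ℝ) : ℂ)) =
      G.villainIntegrand β v₁ v₂ x := by
  set k' : G.V → ℤ := fun v => if h : v = G.root then 0 else k ⟨v, h⟩ with hk'
  have h : ∀ v, G.toFormC (fun i => x i + ((2 * Real.pi * k i : ℝ) : ℂ)) v =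
      G.toFormC x v + 2 * Real.pi * k' v := fun v => by
    by_cases h : v = G.root <;> simp [toFormC, h, hk']
  simp only [villainIntegrand, h]
  congr 1
  · have : Complex.I * (G.toFormC x v₁ + 2 * Real.pi * k' v₁ -
        (G.toFormC x v₂ + 2 * Real.pi * k' v₂)) =
        Complex.I * (G.toFormC x v₁ - G.toFormC x v₂) +
          ((k' v₁ - k' v₂ : ℤ) : ℂ) * (2 * Real.pi * Complex.I) := by
      push_cast; ring
    rw [this, Complex.exp_add, Complex.exp_int_mul_two_pi_mul_I, mul_one]
  · refine Finset.prod_congr rfl fun e _ => ?_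
    rw [← theta_add_period β (G.toFormC x (G.tgt e) - G.toFormC x (G.src e))
      (k' (G.tgt e) - k' (G.src e))]
    congr 1
    push_cast; ring

theorem villainIntegrand_ofReal (β : ℝ) (v₁ v₂ : G.V) (x : G.Coord) :
    G.villainIntegrand β v₁ v₂ (fun i => (x i : ℂ)) =
      Complex.exp (((G.toForm x v₁ - G.toForm x v₂ : ℝ) : ℂ) * Complex.I) *
        (G.villainWeight β (G.toForm x) : ℝ) := by
  rw [villainIntegrand, villainWeight_eq]
  simp only [toFormC_ofReal]
  rw [mul_comm Complex.I]
  push_cast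
  congr 1
  refine Finset.prod_congr rfl fun e _ => ?_
  rw [← theta_ofReal, d]
  push_cast; rfl

theorem villainWeight_pos {β : ℝ} (hβ : 0 < β) (w : G.V → ℝ) : 0 < G.villainWeight β w := by
  rw [villainWeight_eq]
  exact Finset.prod_pos fun e _ => thetaReal_pos hβ _

theorem villainWeight_eq_norm {β : ℝ} (hβ : 0 < β) (v : G.V) (x : G.Coord) :
    G.villainWeight β (G.toForm x) = ‖G.villainIntegrand β v v (fun i => (x i : ℂ))‖ := by
  rw [villainIntegrand_ofReal, norm_mul, Complex.norm_exp_ofReal_mul_I, one_mul, Complex.norm_real,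
    Real.norm_eq_abs, abs_of_pos (villainWeight_pos hβ _)]

/-- Upper bound of the Villain two-point function by edgewise bounds of the complexified weights. -/
theorem villainTwoPoint_le {β : ℝ} (hβ : 0 < β) (v₁ v₂ : G.V) (η : G.Coord) (c : G.E → ℝ)
    (hc : ∀ e x, ‖theta β ((x : ℝ) + Complex.I * (G.d (G.toForm η) e : ℝ))‖ ≤
      Real.exp (c e) * thetaReal β x) :
    G.villainTwoPoint β v₁ v₂ ≤
      Real.exp (-(G.toForm η v₁ - G.toForm η v₂) + ∑ e, c e) := by
  set B : Set G.Coord :=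
    Set.univ.pi fun _ : {v : G.V // v ≠ G.root} => Set.Ico (0 : ℝ) (2 * Real.pi) with hB
  have hBf : volume B < ⊤ := by
    rw [hB, volume_pi_pi]
    exact ENNReal.prod_lt_top fun i _ => by rw [Real.volume_Ico]; exact ENNReal.ofReal_lt_top
  have hB0 : 0 < volume B := by
    rw [hB, volume_pi_pi, pos_iff_ne_zero, Finset.prod_ne_zero_iff]
    intro i _
    simpa using Real.pi_pos
  have hBK : B ⊆ Set.univ.pi fun _ => Set.Icc (0 : ℝ) (2 * Real.pi) :=
    Set.pi_mono fun _ _ => Set.Ico_subset_Icc_self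
  have hKc : IsCompact (Set.univ.pi fun _ : {v : G.V // v ≠ G.root} =>
      Set.Icc (0 : ℝ) (2 * Real.pi)) := isCompact_univ_pi fun _ => isCompact_Icc
  have hint : ∀ {f : G.Coord → ℂ}, Continuous f → IntegrableOn f B := fun hf =>
    (hf.continuousOn.integrableOn_compact hKc).mono_set hBK
  set P := G.villainIntegrand β v₁ v₂ with hP
  have hcont : ∀ v₁ v₂ : G.V, Continuous (G.villainIntegrand β v₁ v₂) := fun v₁ v₂ =>
    (contDiff_villainIntegrand hβ v₁ v₂).continuous
  have hofR : Continuous fun x : G.Coord => fun i => (x i : ℂ) := by fun_prop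
  set W : G.Coord → ℝ := fun x => G.villainWeight β (G.toForm x) with hW
  have hW0 : ∀ x, 0 < W x := fun x => villainWeight_pos hβ _
  have hWc : Continuous W := by
    have : W = fun x => ‖G.villainIntegrand β v₁ v₁ (fun i => (x i : ℂ))‖ :=
      funext fun x => villainWeight_eq_norm hβ v₁ x
    rw [this]
    exact ((hcont _ _).comp hofR).norm
  have hWi : IntegrableOn W B :=
    (hWc.continuousOn.integrableOn_compact hKc).mono_set hBK
  have hZ : 0 < ∫ x in B, W x := by
    refine (setIntegral_pos_iff_support_of_nonneg_ae (ae_of_all _ fun x => (hW0 x).le) hWi).2 ?_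
    have : Function.support W = Set.univ := by
      ext x; simp [(hW0 x).ne']
    rwa [this, Set.univ_inter]
  have hnum : ∫ x in B, W x * Real.cos (G.toForm x v₁ - G.toForm x v₂) ≤
      ‖∫ x in B, P (fun i => (x i : ℂ))‖ := by
    have h1 : ∀ x : G.Coord, W x * Real.cos (G.toForm x v₁ - G.toForm x v₂) =
        Complex.reCLM (P (fun i => (x i : ℂ))) := fun x => by
      rw [hP, villainIntegrand_ofReal, Complex.reCLM_apply, Complex.re_mul_ofReal,
        Complex.exp_ofReal_mul_I_re, mul_comm]
    simp only [h1]
    have hPi : IntegrableOn (fun x : G.Coord => P (fun i => (x i : ℂ))) B :=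
      hint ((hcont _ _).comp hofR)
    rw [Complex.reCLM.integral_comp_comm hPi]
    exact Complex.re_le_norm _
  have hshift := setIntegral_box_shift Real.two_pi_pos (contDiff_villainIntegrand hβ v₁ v₂)
    (villainIntegrand_periodic β v₁ v₂) η
  have hpt : ∀ x : G.Coord, ‖P (fun i => (x i : ℂ) + Complex.I * (η i : ℂ))‖ ≤
      Real.exp (-(G.toForm η v₁ - G.toForm η v₂) + ∑ e, c e) * W x := fun x => by
    rw [hP, villainIntegrand, norm_mul, Complex.norm_exp, norm_prod, Real.exp_add, Real.exp_sum,
      mul_assoc]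
    simp only [toFormC_shift]
    have hre : (Complex.I * ((G.toForm x v₁ : ℂ) + Complex.I * (G.toForm η v₁ : ℂ) -
        ((G.toForm x v₂ : ℂ) + Complex.I * (G.toForm η v₂ : ℂ)))).re =
        -(G.toForm η v₁ - G.toForm η v₂) := by
      simp
    rw [hre]
    refine mul_le_mul_of_nonneg_left ?_ (Real.exp_pos _).le
    simp only [hW]
    rw [villainWeight_eq, ← Finset.prod_mul_distrib]
    refine Finset.prod_le_prod (fun e _ => norm_nonneg _) fun e _ => ?_
    have := hc e (G.d (G.toForm x) e)
    refine le_of_eq_of_le ?_ this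
    congr 2
    simp only [d]
    push_cast; ring
  have hb : ‖∫ x in B, P (fun i => (x i : ℂ))‖ ≤
      Real.exp (-(G.toForm η v₁ - G.toForm η v₂) + ∑ e, c e) * ∫ x in B, W x := by
    rw [hP, ← hshift, ← integral_const_mul]
    refine norm_integral_le_of_norm_le (hWi.const_mul _) (ae_of_all _ hpt)
  rw [villainTwoPoint, villain,
    integral_normalize_withDensity hWc.measurable (fun x => (hW0 x).le) hWi]
  simp only [smul_eq_mul]
  rw [inv_mul_le_iff₀ hZ, mul_comm (∫ x in B, W x)]
  exact hnum.trans hb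

/-- The spin-wave estimate improved by the fluctuations of the integer Gaussians on all but finitely
many edges. -/
theorem villainTwoPoint_le_of_potential (hG : G.IsConn) {ψ : G.Coord} {v₁ v₂ : G.V}
    (hψ : G.IsPotential (G.toForm ψ) v₁ v₂) {β : ℝ} (hβ : 1 / 3 ≤ β) (bad : Finset G.E)
    (hbad : ∀ e, e ∉ bad → |G.d (G.toForm ψ) e| ≤ 1 / 20) :
    G.villainTwoPoint β v₁ v₂ ≤
      Real.exp (Real.pi ^ 2 * bad.card) *
        Real.exp (-(G.toForm ψ v₁ - G.toForm ψ v₂) / (2 * β) *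
          (1 + errorFunction β / 2)) := by
  classical
  have hβ0 : 0 < β := by linarith
  set v := ⨅ a : Set.Icc (0 : ℝ) (1 / 2), varIG (a : ℝ) ((2 * Real.pi) ^ 2 * β) with hv
  have hv1 : v ≤ 1 := by
    have hb : 13 ≤ (2 * Real.pi) ^ 2 * β := by
      have := Real.pi_gt_d2
      nlinarith [mul_pos Real.pi_pos Real.pi_pos]
    have h1 := iInf_varIG_le hb
    have h2 := exp_neg_half_le hb
    linarith
  -- This is the shift minimising the spin-wave exponent `-(η v₁ - η v₂) + (β/2) ∑ (dη)²`.
  set η : G.Coord := β⁻¹ • ψ with hη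
  have hηf : G.toForm η = β⁻¹ • G.toForm ψ := G.toFormₗ.map_smul β⁻¹ ψ
  have hdη : ∀ e, G.d (G.toForm η) e = β⁻¹ * G.d (G.toForm ψ) e := fun e => by rw [hηf, d_smul]
  set D : G.E → ℝ := fun e => G.d (G.toForm ψ) e with hD
  -- The gain `π² v D²` is `v t² / 4` at `t = 2πD`. It is subtracted on all edges so that it sums to
  -- the energy; on a bad edge the added `π²` repays it, because `v ≤ 1` and `|D| ≤ 1`.
  set c : G.E → ℝ := fun e => D e ^ 2 / (2 * β) - Real.pi ^ 2 * v * D e ^ 2 +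
    Real.pi ^ 2 * (if e ∈ bad then 1 else 0) with hc
  have h := villainTwoPoint_le hβ0 v₁ v₂ η c (fun e x => by
    have hy : β * (G.d (G.toForm η) e) ^ 2 / 2 = D e ^ 2 / (2 * β) := by
      rw [hdη]; simp only [hD]; field_simp
    have hy2 : 2 * Real.pi * β * G.d (G.toForm η) e = 2 * Real.pi * D e := by
      rw [hdη]; simp only [hD]; field_simp
    by_cases he : e ∈ bad
    · refine (norm_theta_le hβ0 x _).trans ?_
      refine mul_le_mul_of_nonneg_right (Real.exp_le_exp.2 ?_) (thetaReal_pos hβ0 x).le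
      rw [hy, hc]
      simp only [he, if_true, mul_one]
      have hD1 : D e ^ 2 ≤ 1 := by
        rw [← sq_abs]
        exact pow_le_one₀ (abs_nonneg _) (hψ.abs_d_le_one hG e)
      have h3 : v * D e ^ 2 ≤ 1 := mul_le_one₀ hv1 (sq_nonneg _) hD1
      nlinarith [sq_nonneg Real.pi]
    -- The threshold `1/20` is chosen so that `2π / 20 < 0.4`.
    · have hs : |2 * Real.pi * β * G.d (G.toForm η) e| ≤ 0.4 := by
        rw [hy2, abs_mul, abs_of_pos Real.two_pi_pos]
        have h1 := hbad e he
        have := Real.pi_lt_d2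
        nlinarith [abs_nonneg (G.d (G.toForm ψ) e)]
      refine (norm_theta_le_of_small hβ x hs).trans_eq ?_
      rw [hy, hy2, hc]
      simp only [he, if_false, mul_zero, add_zero]
      congr 2
      ring)
  refine h.trans ?_
  rw [← Real.exp_add]
  refine Real.exp_le_exp.2 (le_of_eq ?_)
  have hsum : ∑ e, c e = (G.toForm ψ v₁ - G.toForm ψ v₂) / (2 * β) -
      Real.pi ^ 2 * v * (G.toForm ψ v₁ - G.toForm ψ v₂) + Real.pi ^ 2 * bad.card := by
    rw [← hψ.energy, hc, Finset.sum_add_distrib, Finset.sum_sub_distrib, ← Finset.sum_div,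
      ← Finset.mul_sum, ← Finset.mul_sum]
    congr 2
    simp
  rw [hsum, errorFunction, ← hv, hηf]
  simp only [Pi.smul_apply, smul_eq_mul]
  field_simp
  ring

end RootedGraph

/-! ### Oscillation on concentric squares -/

/-- The square of radius `r` around `c`. -/
def InBall (c : ℤ × ℤ) (r : ℤ) (p : ℤ × ℤ) : Prop :=
  c.1 - r ≤ p.1 ∧ p.1 ≤ c.1 + r ∧ c.2 - r ≤ p.2 ∧ p.2 ≤ c.2 + r

/-- The boundary of the square of radius `r` around `c`. -/
def OnRing (c : ℤ × ℤ) (r : ℤ) (p : ℤ × ℤ) : Prop :=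
  InBall c r p ∧ (p.1 = c.1 - r ∨ p.1 = c.1 + r ∨ p.2 = c.2 - r ∨ p.2 = c.2 + r)

/-- `κ` bounds the increments of `F` along the lattice edges inside `I₁ × I₂`. -/
structure EdgeBound (I₁ I₂ : Set ℤ) (F : ℤ × ℤ → ℝ) (κ : LatticeEdge → ℝ) : Prop where
  nonneg : ∀ e, 0 ≤ κ e
  hor : ∀ k y, k ∈ I₁ → k + 1 ∈ I₁ → y ∈ I₂ → |F (k + 1, y) - F (k, y)| ≤ κ ((k, y), false)
  ver : ∀ x k, x ∈ I₁ → k ∈ I₂ → k + 1 ∈ I₂ → |F (x, k + 1) - F (x, k)| ≤ κ ((x, k), true)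

theorem abs_sub_le_sum_Icc {f κ : ℤ → ℝ} {I : Set ℤ} (hI : I.OrdConnected) (h0 : ∀ k, 0 ≤ κ k)
    (hκ : ∀ k, k ∈ I → k + 1 ∈ I → |f (k + 1) - f k| ≤ κ k) {lo hi a b : ℤ}
    (ha : a ∈ I) (hb : b ∈ I) (ha' : a ∈ Set.Icc lo hi) (hb' : b ∈ Set.Icc lo hi) :
    |f b - f a| ≤ ∑ k ∈ Finset.Icc lo hi, κ k := by
  have key : ∀ a ∈ I, a ∈ Set.Icc lo hi → ∀ b, a ≤ b → b ∈ I →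
      |f b - f a| ≤ ∑ k ∈ Finset.Ico a b, κ k := by
    intro a ha _ b hab
    induction b, hab using Int.leInduction with
    | base => simp
    | succ b hab ih =>
      intro hb
      have hbI : b ∈ I := hI.out ha hb ⟨hab, by omega⟩
      have hs : Finset.Ico a (b + 1) = insert b (Finset.Ico a b) := by
        ext k; simp only [Finset.mem_Ico, Finset.mem_insert]; omega
      rw [hs, Finset.sum_insert (by simp)]
      calc |f (b + 1) - f a| = |(f (b + 1) - f b) + (f b - f a)| := by ring_nf
        _ ≤ |f (b + 1) - f b| + |f b - f a| := abs_add_le _ _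
        _ ≤ _ := add_le_add (hκ b hbI hb) (ih hbI)
  have sub : ∀ a b, a ∈ Set.Icc lo hi → b ∈ Set.Icc lo hi →
      ∑ k ∈ Finset.Ico a b, κ k ≤ ∑ k ∈ Finset.Icc lo hi, κ k := fun a b ha hb =>
    Finset.sum_le_sum_of_subset_of_nonneg (fun k hk => by
      simp only [Finset.mem_Ico, Finset.mem_Icc, Set.mem_Icc] at *; omega) fun k _ _ => h0 k
  rcases le_total a b with h | h
  · exact (key a ha ha' b h hb).trans (sub a b ha' hb')
  · rw [abs_sub_comm]
    exact (key b hb hb' a h ha).trans (sub b a hb' ha')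

section Ring

variable (κ : LatticeEdge → ℝ) (c : ℤ × ℤ) (r : ℤ)

/-- The sum of `κ` along the four sides of a square. -/
noncomputable def ringSum : ℝ :=
  ∑ k ∈ Finset.Icc (c.1 - r) (c.1 + r), κ ((k, c.2 + r), false) +
  ∑ k ∈ Finset.Icc (c.1 - r) (c.1 + r), κ ((k, c.2 - r), false) +
  ∑ k ∈ Finset.Icc (c.2 - r) (c.2 + r), κ ((c.1 + r, k), true) +
  ∑ k ∈ Finset.Icc (c.2 - r) (c.2 + r), κ ((c.1 - r, k), true)

end Ring

/-- The point is joined to the corner by one horizontal and one vertical run, both on the ring and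
both inside `I₁ × I₂`. One available corner is thus enough even when the ring is clipped by the
domain. -/
theorem EdgeBound.abs_sub_corner_le {I₁ I₂ : Set ℤ} (h₁ : I₁.OrdConnected) (h₂ : I₂.OrdConnected)
    {F : ℤ × ℤ → ℝ} {κ : LatticeEdge → ℝ} (h : EdgeBound I₁ I₂ F κ) {c : ℤ × ℤ} {r : ℤ}
    {x y : ℤ} (hx : x = c.1 + r ∨ x = c.1 - r) (hy : y = c.2 + r ∨ y = c.2 - r)
    (hxI : x ∈ I₁) (hyI : y ∈ I₂) {p : ℤ × ℤ} (hp : OnRing c r p) (hp₁ : p.1 ∈ I₁)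
    (hp₂ : p.2 ∈ I₂) : |F p - F (x, y)| ≤ ringSum κ c r := by
  obtain ⟨p₁, p₂⟩ := p
  obtain ⟨⟨hb1, hb2, hb3, hb4⟩, hs⟩ := hp
  simp only at hp₁ hp₂ hb1 hb2 hb3 hb4 hs
  have n1 : 0 ≤ ∑ k ∈ Finset.Icc (c.1 - r) (c.1 + r), κ ((k, c.2 + r), false) :=
    Finset.sum_nonneg fun k _ => h.nonneg _
  have n2 : 0 ≤ ∑ k ∈ Finset.Icc (c.1 - r) (c.1 + r), κ ((k, c.2 - r), false) :=
    Finset.sum_nonneg fun k _ => h.nonneg _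
  have n3 : 0 ≤ ∑ k ∈ Finset.Icc (c.2 - r) (c.2 + r), κ ((c.1 + r, k), true) :=
    Finset.sum_nonneg fun k _ => h.nonneg _
  have n4 : 0 ≤ ∑ k ∈ Finset.Icc (c.2 - r) (c.2 + r), κ ((c.1 - r, k), true) :=
    Finset.sum_nonneg fun k _ => h.nonneg _
  have hxm : x ∈ Set.Icc (c.1 - r) (c.1 + r) := by simp only [Set.mem_Icc]; omega
  have hym : y ∈ Set.Icc (c.2 - r) (c.2 + r) := by simp only [Set.mem_Icc]; omega
  have hpm1 : p₁ ∈ Set.Icc (c.1 - r) (c.1 + r) := ⟨hb1, hb2⟩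
  have hpm2 : p₂ ∈ Set.Icc (c.2 - r) (c.2 + r) := ⟨hb3, hb4⟩
  have row : ∀ z ∈ I₂, (z = c.2 + r ∨ z = c.2 - r) → ∀ a b, a ∈ I₁ → b ∈ I₁ →
      a ∈ Set.Icc (c.1 - r) (c.1 + r) → b ∈ Set.Icc (c.1 - r) (c.1 + r) →
      |F (b, z) - F (a, z)| ≤ ∑ k ∈ Finset.Icc (c.1 - r) (c.1 + r), κ ((k, c.2 + r), false) +
        ∑ k ∈ Finset.Icc (c.1 - r) (c.1 + r), κ ((k, c.2 - r), false) := by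
    intro z hz hzr a b ha hb ha' hb'
    have := abs_sub_le_sum_Icc (f := fun k => F (k, z)) (κ := fun k => κ ((k, z), false)) h₁
      (fun k => h.nonneg _) (fun k hk hk' => h.hor k z hk hk' hz) ha hb ha' hb'
    rcases hzr with rfl | rfl <;> linarith
  have col : ∀ z ∈ I₁, (z = c.1 + r ∨ z = c.1 - r) → ∀ a b, a ∈ I₂ → b ∈ I₂ →
      a ∈ Set.Icc (c.2 - r) (c.2 + r) → b ∈ Set.Icc (c.2 - r) (c.2 + r) →
      |F (z, b) - F (z, a)| ≤ ∑ k ∈ Finset.Icc (c.2 - r) (c.2 + r), κ ((c.1 + r, k), true) +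
        ∑ k ∈ Finset.Icc (c.2 - r) (c.2 + r), κ ((c.1 - r, k), true) := by
    intro z hz hzr a b ha hb ha' hb'
    have := abs_sub_le_sum_Icc (f := fun k => F (z, k)) (κ := fun k => κ ((z, k), true)) h₂
      (fun k => h.nonneg _) (fun k hk hk' => h.ver z k hz hk hk') ha hb ha' hb'
    rcases hzr with rfl | rfl <;> linarith
  have tri : ∀ u v w : ℝ, |u - w| ≤ |u - v| + |v - w| := fun u v w => abs_sub_le u v w
  rw [ringSum]
  by_cases hv : p₁ = c.1 - r ∨ p₁ = c.1 + r
  · have h1 := col p₁ hp₁ hv.symm y p₂ hyI hp₂ hym hpm2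
    have h2 := row y hyI hy x p₁ hxI hp₁ hxm hpm1
    have := tri (F (p₁, p₂)) (F (p₁, y)) (F (x, y))
    linarith
  · have hv' : p₂ = c.2 + r ∨ p₂ = c.2 - r := by omega
    have h1 := row p₂ hp₂ hv' x p₁ hxI hp₁ hxm hpm1
    have h2 := col x hxI hx y p₂ hyI hp₂ hym hpm2
    have := tri (F (p₁, p₂)) (F (x, p₂)) (F (x, y))
    linarith

theorem EdgeBound.eq_of_zero {I₁ I₂ : Set ℤ} (h₁ : I₁.OrdConnected) (h₂ : I₂.OrdConnected)
    {F : ℤ × ℤ → ℝ} (h : EdgeBound I₁ I₂ F fun _ => 0) {p q : ℤ × ℤ} (hp₁ : p.1 ∈ I₁)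
    (hp₂ : p.2 ∈ I₂) (hq₁ : q.1 ∈ I₁) (hq₂ : q.2 ∈ I₂) : F p = F q := by
  obtain ⟨p₁, p₂⟩ := p
  obtain ⟨q₁, q₂⟩ := q
  have e1 := abs_sub_le_sum_Icc (f := fun k => F (k, p₂)) (κ := fun _ => 0) h₁
    (fun k => le_rfl) (fun k hk hk' => h.hor k p₂ hk hk' hp₂) hq₁ hp₁
    (lo := min p₁ q₁) (hi := max p₁ q₁) (by simp) (by simp)
  have e2 := abs_sub_le_sum_Icc (f := fun k => F (q₁, k)) (κ := fun _ => 0) h₂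
    (fun k => le_rfl) (fun k hk hk' => h.ver q₁ k hq₁ hk hk') hq₂ hp₂
    (lo := min p₂ q₂) (hi := max p₂ q₂) (by simp) (by simp)
  simp only [Finset.sum_const_zero] at e1 e2
  have e1' := abs_nonpos_iff.1 e1
  have e2' := abs_nonpos_iff.1 e2
  linarith

/-- Cauchy–Schwarz with four sides of `2r + 1 ≤ 3r` terms each. -/
theorem ringSum_sq_le (κ : LatticeEdge → ℝ) (c : ℤ × ℤ) {r : ℕ} (hr : 1 ≤ r) :
    ringSum κ c r ^ 2 ≤ 12 * r * ringSum (fun e => κ e ^ 2) c r := by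
  have hcard : ∀ a : ℤ, ((Finset.Icc (a - r) (a + r)).card : ℝ) ≤ 3 * r := fun a => by
    rw [Int.card_Icc]
    have : (a + r + 1 - (a - r)).toNat ≤ 3 * r := by omega
    exact_mod_cast this
  have side : ∀ (a : ℤ) (f : ℤ → ℝ), (∑ k ∈ Finset.Icc (a - r) (a + r), f k) ^ 2 ≤
      3 * r * ∑ k ∈ Finset.Icc (a - r) (a + r), f k ^ 2 := fun a f =>
    (sq_sum_le_card_mul_sum_sq).trans
      (mul_le_mul_of_nonneg_right (hcard a) (Finset.sum_nonneg fun k _ => sq_nonneg _))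
  rw [ringSum, ringSum]
  have s1 := side c.1 fun k => κ ((k, c.2 + r), false)
  have s2 := side c.1 fun k => κ ((k, c.2 - r), false)
  have s3 := side c.2 fun k => κ ((c.1 + r, k), true)
  have s4 := side c.2 fun k => κ ((c.1 - r, k), true)
  set a := ∑ k ∈ Finset.Icc (c.1 - r) (c.1 + r), κ ((k, c.2 + r), false)
  set b := ∑ k ∈ Finset.Icc (c.1 - r) (c.1 + r), κ ((k, c.2 - r), false)
  set d := ∑ k ∈ Finset.Icc (c.2 - r) (c.2 + r), κ ((c.1 + r, k), true)
  set e := ∑ k ∈ Finset.Icc (c.2 - r) (c.2 + r), κ ((c.1 - r, k), true)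
  nlinarith [sq_nonneg (a - b), sq_nonneg (a - d), sq_nonneg (a - e), sq_nonneg (b - d),
    sq_nonneg (b - e), sq_nonneg (d - e)]

/-- For a fixed side, different radii use different edges, so each of the four sides contributes at
most the total mass `1`. -/
theorem sum_ringSum_le {κ : LatticeEdge → ℝ}
    (hE : ∀ S : Finset LatticeEdge, ∑ e ∈ S, κ e ≤ 1) (c : ℤ × ℤ) (N : ℕ) :
    ∑ r ∈ Finset.range N, ringSum κ c ((r + 1 : ℕ) : ℤ) ≤ 4 := by
  classical
  have side : ∀ (a : ℤ) (φ : ℕ → ℤ → LatticeEdge),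
      (∀ r k r' k', φ r k = φ r' k' → r = r' ∧ k = k') →
      ∑ r ∈ Finset.range N, ∑ k ∈ Finset.Icc (a - ((r + 1 : ℕ) : ℤ)) (a + ((r + 1 : ℕ) : ℤ)),
        κ (φ r k) ≤ 1 := by
    intro a φ hφ
    rw [Finset.sum_sigma']
    have := Finset.sum_image (f := κ) (g := fun x : (_ : ℕ) × ℤ => φ x.1 x.2)
      (s := (Finset.range N).sigma fun r =>
        Finset.Icc (a - ((r + 1 : ℕ) : ℤ)) (a + ((r + 1 : ℕ) : ℤ)))
      (by
        rintro ⟨r, k⟩ _ ⟨r', k'⟩ _ h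
        obtain ⟨rfl, rfl⟩ := hφ r k r' k' h
        rfl)
    rw [← this]
    exact hE _
  simp only [ringSum, Finset.sum_add_distrib]
  have s1 := side c.1 (fun r k => ((k, c.2 + ((r + 1 : ℕ) : ℤ)), false)) (by
    intro r k r' k' h; simp only [Prod.mk.injEq] at h; omega)
  have s2 := side c.1 (fun r k => ((k, c.2 - ((r + 1 : ℕ) : ℤ)), false)) (by
    intro r k r' k' h; simp only [Prod.mk.injEq] at h; omega)
  have s3 := side c.2 (fun r k => ((c.1 + ((r + 1 : ℕ) : ℤ), k), true)) (by
    intro r k r' k' h; simp only [Prod.mk.injEq] at h; omega)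
  have s4 := side c.2 (fun r k => ((c.1 - ((r + 1 : ℕ) : ℤ), k), true)) (by
    intro r k r' k' h; simp only [Prod.mk.injEq] at h; omega)
  linarith

/-- Length-area estimate: if a function of energy at most `1` has oscillation at least `δ` on each of
the first `N` concentric squares, then `δ` is small. -/
theorem exists_radius {ε : ℝ} (hε : 0 < ε) :
    ∃ N : ℕ, ∀ (I₁ I₂ : Set ℤ), I₁.OrdConnected → I₂.OrdConnected → ∀ (F : ℤ × ℤ → ℝ)
      (κ : LatticeEdge → ℝ), EdgeBound I₁ I₂ F κ →
      (∀ S : Finset LatticeEdge, ∑ e ∈ S, κ e ^ 2 ≤ 1) → ∀ (c : ℤ × ℤ),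
      (∀ r : ℕ, r ≤ N → (c.1 + r ∈ I₁ ∨ c.1 - r ∈ I₁) ∧ (c.2 + r ∈ I₂ ∨ c.2 - r ∈ I₂)) →
      ∀ δ : ℝ, (∀ r : ℕ, 1 ≤ r → r ≤ N → ∃ p q : ℤ × ℤ, OnRing c r p ∧ OnRing c r q ∧
        p.1 ∈ I₁ ∧ p.2 ∈ I₂ ∧ q.1 ∈ I₁ ∧ q.2 ∈ I₂ ∧ δ ≤ F p - F q) → δ ≤ ε := by
  -- An oscillation `δ` forces `δ ≤ 2 · ringSum`, hence `δ² / r ≤ 48` times the energy on the ring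
  -- of radius `r`. The ring energies add up to at most `4`, which gives `192`.
  obtain ⟨N, hN⟩ := (Real.tendsto_sum_range_one_div_nat_succ_atTop.eventually_gt_atTop
    (192 / ε ^ 2)).exists
  refine ⟨N, fun I₁ I₂ h₁ h₂ F κ h hE c hcor δ hδ => ?_⟩
  by_contra! hlt
  have hε2 : ε ^ 2 < δ ^ 2 := by nlinarith
  have hr : ∀ r ∈ Finset.range N, ε ^ 2 * (1 / ((r : ℝ) + 1)) ≤
      48 * ringSum (fun e => κ e ^ 2) c ((r + 1 : ℕ) : ℤ) := by
    intro r hr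
    have hrN : r + 1 ≤ N := Finset.mem_range.1 hr
    obtain ⟨p, q, hp, hq, hp1, hp2, hq1, hq2, hpq⟩ := hδ (r + 1) (by omega) hrN
    obtain ⟨x, hx, hxI⟩ : ∃ x, (x = c.1 + ((r + 1 : ℕ) : ℤ) ∨ x = c.1 - ((r + 1 : ℕ) : ℤ)) ∧
        x ∈ I₁ := by
      rcases (hcor (r + 1) hrN).1 with h | h
      exacts [⟨_, Or.inl rfl, h⟩, ⟨_, Or.inr rfl, h⟩]
    obtain ⟨y, hy, hyI⟩ : ∃ y, (y = c.2 + ((r + 1 : ℕ) : ℤ) ∨ y = c.2 - ((r + 1 : ℕ) : ℤ)) ∧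
        y ∈ I₂ := by
      rcases (hcor (r + 1) hrN).2 with h | h
      exacts [⟨_, Or.inl rfl, h⟩, ⟨_, Or.inr rfl, h⟩]
    have b1 := h.abs_sub_corner_le h₁ h₂ hx hy hxI hyI hp hp1 hp2
    have b2 := h.abs_sub_corner_le h₁ h₂ hx hy hxI hyI hq hq1 hq2
    have b3 := ringSum_sq_le κ c (r := r + 1) (by omega)
    have b4 : δ ≤ 2 * ringSum κ c ((r + 1 : ℕ) : ℤ) := by
      have := (abs_le.1 b1).2
      have := (abs_le.1 b2).1
      linarith
    have hr0 : (0 : ℝ) < (r : ℝ) + 1 := by positivity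
    rw [mul_one_div, div_le_iff₀ hr0]
    have b5 : δ ^ 2 ≤ (2 * ringSum κ c ((r + 1 : ℕ) : ℤ)) ^ 2 :=
      pow_le_pow_left₀ (by linarith) b4 2
    have b6 : ((r + 1 : ℕ) : ℝ) = (r : ℝ) + 1 := by push_cast; ring
    rw [b6] at b3
    nlinarith
  have hsum := Finset.sum_le_sum hr
  rw [← Finset.mul_sum, ← Finset.mul_sum] at hsum
  have h4 := sum_ringSum_le hE c N
  rw [div_lt_iff₀ (by positivity)] at hN
  linarith

/-! ### The two families of graphs -/

theorem mem_box {n : ℕ} {p : ℤ × ℤ} :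
    p ∈ box n ↔ (-(n : ℤ) ≤ p.1 ∧ p.1 ≤ n) ∧ (-(n : ℤ) ≤ p.2 ∧ p.2 ≤ n) := by
  simp [box]

theorem head_cases (e : LatticeEdge) :
    (LatticeEdge.head e).1 = e.1.1 + 1 ∧ (LatticeEdge.head e).2 = e.1.2 ∨
      (LatticeEdge.head e).1 = e.1.1 ∧ (LatticeEdge.head e).2 = e.1.2 + 1 := by
  rcases e with ⟨p, _ | _⟩ <;> simp [LatticeEdge.head]

theorem mem_innerEdges {n : ℕ} {e : LatticeEdge} :
    e ∈ innerEdges n ↔ e.1 ∈ box n ∧ LatticeEdge.head e ∈ box n := by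
  simp [innerEdges]

theorem mem_touchingEdges {n : ℕ} {e : LatticeEdge} :
    e ∈ touchingEdges n ↔ e.1 ∈ box n ∨ LatticeEdge.head e ∈ box n := by
  simp only [touchingEdges, Finset.mem_filter, Finset.mem_product, Finset.mem_univ, and_true,
    and_iff_right_iff_imp]
  have := head_cases e
  simp only [mem_box]
  push_cast
  omega

/-- Points of the ball of radius `r` around `c`. -/
noncomputable def ballFinset (c : ℤ × ℤ) (r : ℤ) : Finset (ℤ × ℤ) :=
  Finset.Icc (c.1 - r) (c.1 + r) ×ˢ Finset.Icc (c.2 - r) (c.2 + r)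

theorem mem_ballFinset {c p : ℤ × ℤ} {r : ℤ} : p ∈ ballFinset c r ↔ InBall c r p := by
  simp [ballFinset, InBall, and_assoc]

theorem card_ballFinset (c : ℤ × ℤ) (r : ℕ) : (ballFinset c r).card = (2 * r + 1) ^ 2 := by
  rw [ballFinset, Finset.card_product, Int.card_Icc, Int.card_Icc, sq]
  congr 1 <;> omega

/-- Few edges start near one of two given points. -/
theorem card_near_le (S : Finset LatticeEdge) (P : Finset (ℤ × ℤ)) (hP : P.card ≤ 2) (N : ℕ)
    (B : Finset S) (hB : ∀ e ∈ B, ∃ p ∈ P, InBall e.1.1 N p) :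
    B.card ≤ 4 * (2 * N + 1) ^ 2 := by
  classical
  have hsub : B.map (Function.Embedding.subtype _) ⊆
      (P.biUnion fun p => ballFinset p N) ×ˢ (Finset.univ : Finset Bool) := by
    intro e he
    obtain ⟨e', he', rfl⟩ := Finset.mem_map.1 he
    obtain ⟨p, hp, h⟩ := hB e' he'
    refine Finset.mem_product.2 ⟨Finset.mem_biUnion.2 ⟨p, hp, mem_ballFinset.2 ?_⟩, Finset.mem_univ _⟩
    simp only [InBall] at h ⊢
    simp only [Function.Embedding.subtype_apply]
    omega
  have h1 := Finset.card_le_card hsub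
  rw [Finset.card_map, Finset.card_product, Finset.card_univ, Fintype.card_bool] at h1
  have h2 : (P.biUnion fun p => ballFinset p N).card ≤ P.card * (2 * N + 1) ^ 2 :=
    Finset.card_biUnion_le_card_mul _ _ _ fun p _ => (card_ballFinset p N).le
  have h3 : P.card * (2 * N + 1) ^ 2 ≤ 2 * (2 * N + 1) ^ 2 := Nat.mul_le_mul_right _ hP
  omega

/-- A maximum over the part of a ring inside a set. -/
theorem exists_max_onRing (c : ℤ × ℤ) (r : ℤ) (F : ℤ × ℤ → ℝ) (Ω : Set (ℤ × ℤ))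
    (hne : ∃ p, OnRing c r p ∧ p ∈ Ω) :
    ∃ p, OnRing c r p ∧ p ∈ Ω ∧ ∀ q, OnRing c r q → q ∈ Ω → F q ≤ F p := by
  classical
  obtain ⟨p₀, h₀, h₀'⟩ := hne
  obtain ⟨p, hp, hmax⟩ := ((ballFinset c r).filter fun p => OnRing c r p ∧ p ∈ Ω).exists_max_image F
    ⟨p₀, Finset.mem_filter.2 ⟨mem_ballFinset.2 h₀.1, h₀, h₀'⟩⟩
  obtain ⟨h1, h2, h3⟩ := Finset.mem_filter.1 hp
  exact ⟨p, h2, h3, fun q hq hq' => hmax q (Finset.mem_filter.2 ⟨mem_ballFinset.2 hq.1, hq, hq'⟩)⟩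

/-! #### Zero boundary condition -/

theorem contract_of_mem {n : ℕ} {p : ℤ × ℤ} (h : p ∈ box n) : contract n p = some ⟨p, h⟩ :=
  dif_pos h

theorem contract_of_notMem {n : ℕ} {p : ℤ × ℤ} (h : p ∉ box n) : contract n p = none :=
  dif_neg h

theorem contract_surjective (n : ℕ) (v : Option (box n)) : ∃ p, contract n p = v := by
  rcases v with _ | ⟨p, hp⟩
  · refine ⟨(n + 1, 0), contract_of_notMem ?_⟩
    rw [mem_box]; omega
  · exact ⟨p, contract_of_mem hp⟩

theorem contract_eq {n : ℕ} {p q : ℤ × ℤ} (h : contract n p = contract n q) :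
    p = q ∨ p ∉ box n ∧ q ∉ box n := by
  by_cases hp : p ∈ box n <;> by_cases hq : q ∈ box n
  · rw [contract_of_mem hp, contract_of_mem hq] at h
    left
    simpa using h
  · rw [contract_of_mem hp, contract_of_notMem hq] at h; cases h
  · rw [contract_of_notMem hp, contract_of_mem hq] at h; cases h
  · exact Or.inr ⟨hp, hq⟩

/-- The increments of a function on the contracted lattice. -/
noncomputable def zeroIncrement (n : ℕ) (w : Option (box n) → ℝ) (e : LatticeEdge) : ℝ :=
  w (contract n (LatticeEdge.head e)) - w (contract n e.1)

theorem zeroIncrement_eq_zero {n : ℕ} (w : Option (box n) → ℝ) {e : LatticeEdge}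
    (he : e ∉ touchingEdges n) : zeroIncrement n w e = 0 := by
  rw [mem_touchingEdges, not_or] at he
  rw [zeroIncrement, contract_of_notMem he.1, contract_of_notMem he.2, sub_self]

theorem zero_edgeBound (n : ℕ) (w : Option (box n) → ℝ) :
    EdgeBound Set.univ Set.univ (fun p => w (contract n p)) fun e => |zeroIncrement n w e| where
  nonneg _ := abs_nonneg _
  hor _ _ _ _ _ := le_rfl
  ver _ _ _ _ _ := le_rfl

theorem zeroGraph_isConn (n : ℕ) : (zeroGraph n).IsConn := by
  intro w hw u v
  change Option (box n) → ℝ at w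
  have h0 : (fun e => |zeroIncrement n w e|) = fun _ => 0 := by
    funext e
    by_cases he : e ∈ touchingEdges n
    · have h := hw (⟨e, he⟩ : touchingEdges n)
      rw [abs_eq_zero]
      exact h
    · rw [zeroIncrement_eq_zero w he, abs_zero]
  have hb := zero_edgeBound n w
  rw [h0] at hb
  obtain ⟨p, hp⟩ := contract_surjective n u
  obtain ⟨q, hq⟩ := contract_surjective n v
  have := hb.eq_of_zero Set.ordConnected_univ Set.ordConnected_univ (p := p) (q := q)
    trivial trivial trivial trivial
  simp only [hp, hq] at this
  exact this

theorem zero_energy (n : ℕ) (w : Option (box n) → ℝ) (S : Finset LatticeEdge) :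
    ∑ e ∈ S, |zeroIncrement n w e| ^ 2 ≤
      ∑ e : (zeroGraph n).E, (zeroGraph n).d w e ^ 2 := by
  have h : ∑ e : (zeroGraph n).E, (zeroGraph n).d w e ^ 2 =
      ∑ e ∈ touchingEdges n, zeroIncrement n w e ^ 2 :=
    Finset.sum_coe_sort (touchingEdges n) fun e => zeroIncrement n w e ^ 2
  rw [h]
  simp only [sq_abs]
  rw [← Finset.sum_filter_of_ne (s := S) (p := fun e => e ∈ touchingEdges n) fun e _ hne => by
    by_contra he
    exact hne (by rw [zeroIncrement_eq_zero w he]; norm_num)]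
  exact Finset.sum_le_sum_of_subset_of_nonneg (fun e he => (Finset.mem_filter.1 he).2)
    fun e _ _ => sq_nonneg _

theorem onRing_sides (c : ℤ × ℤ) {r : ℤ} (hr : 0 ≤ r) :
    (OnRing c r (c.1 + r, c.2) ∧ OnRing c r (c.1 - r, c.2)) ∧
      OnRing c r (c.1, c.2 + r) ∧ OnRing c r (c.1, c.2 - r) := by
  refine ⟨⟨⟨?_, Or.inr (Or.inl rfl)⟩, ⟨?_, Or.inl rfl⟩⟩, ⟨?_, Or.inr (Or.inr (Or.inr rfl))⟩,
    ⟨?_, Or.inr (Or.inr (Or.inl rfl))⟩⟩ <;> simp only [InBall] <;> omega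

/-- If the ball leaves the box in some coordinate direction, so does the midpoint of the side of the
ring in that direction. Thus `∞` is represented on the ring whenever it is represented in the ball.
-/
theorem exists_onRing_notMem_box {n : ℕ} {c q : ℤ × ℤ} {r : ℤ} (hq : InBall c r q)
    (hqn : q ∉ box n) : ∃ p, OnRing c r p ∧ p ∉ box n := by
  have hr : 0 ≤ r := by simp only [InBall] at hq; omega
  obtain ⟨⟨o1, o2⟩, o3, o4⟩ := onRing_sides c hr
  simp only [InBall] at hq
  simp only [mem_box] at hqn ⊢
  by_cases h1 : (n : ℤ) < q.1
  · exact ⟨_, o1, by simp only; omega⟩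
  by_cases h2 : q.1 < -(n : ℤ)
  · exact ⟨_, o2, by simp only; omega⟩
  by_cases h3 : (n : ℤ) < q.2
  · exact ⟨_, o3, by simp only; omega⟩
  · exact ⟨_, o4, by simp only; omega⟩

theorem onRing_of_adjacent {c : ℤ × ℤ} {r : ℤ} (e : LatticeEdge)
    (h : InBall c r e.1 ∧ ¬ InBall c r (LatticeEdge.head e)) : OnRing c r e.1 := by
  have := head_cases e
  simp only [OnRing, InBall] at *
  omega

theorem onRing_of_adjacent' {c : ℤ × ℤ} {r : ℤ} (e : LatticeEdge)
    (h : InBall c r (LatticeEdge.head e) ∧ ¬ InBall c r e.1) :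
    OnRing c r (LatticeEdge.head e) := by
  have := head_cases e
  simp only [OnRing, InBall] at *
  omega

theorem inBall_self (e : LatticeEdge) {r : ℤ} (hr : 1 ≤ r) :
    InBall e.1 r e.1 ∧ InBall e.1 r (LatticeEdge.head e) := by
  have := head_cases e
  simp only [InBall]
  omega

/-- Maximum principle on the vertices with no representative in the ball, with both poles excluded.
A neighbour outside this set either lies on the ring or is `∞`, which is then itself represented on
the ring. The hypothesis on `v` leaves `v = ∞` unrestricted for the same reason. -/
theorem zero_le_onRing {n : ℕ} {g : Option (box n) → ℝ} {x y : Option (box n)}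
    (hg : (zeroGraph n).IsPotential g x y) {c : ℤ × ℤ} {r : ℤ} (hr : 0 ≤ r)
    (hx : ∃ p, InBall c r p ∧ contract n p = x) (hy : ∃ p, InBall c r p ∧ contract n p = y)
    {v : Option (box n)} (hv : ∀ p, v = some p → ¬ InBall c r p) :
    ∃ p, OnRing c r p ∧ g v ≤ g (contract n p) := by
  obtain ⟨p, hp, -, hmax⟩ := exists_max_onRing c r (fun p => g (contract n p)) Set.univ
    ⟨_, (onRing_sides c hr).1.1, trivial⟩
  refine ⟨p, hp, ?_⟩
  have hcase : ∀ q u, InBall c r q → ¬ InBall c r u → contract n q = contract n u →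
      g (contract n u) ≤ g (contract n p) := by
    intro q u hq hu hqu
    rcases contract_eq hqu with rfl | ⟨h1, h2⟩
    · exact absurd hq hu
    · obtain ⟨s, hs, hs'⟩ := exists_onRing_notMem_box hq h1
      have := hmax s hs trivial
      rwa [contract_of_notMem hs', ← contract_of_notMem h2] at this
  set D : Set (Option (box n)) := {v | ∀ p, InBall c r p → contract n p ≠ v} with hD
  by_cases hvD : v ∈ D
  · refine hg.le_of_boundary (zeroGraph_isConn n) D ?_ ?_ _ ?_ ?_ hvD
    · obtain ⟨q, hq, hqx⟩ := hx
      exact fun h => h q hq hqx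
    · obtain ⟨q, hq, hqx⟩ := hy
      exact fun h => h q hq hqx
    · intro e he
      by_cases ht : (zeroGraph n).tgt e ∈ D
      · exact Or.inl ht
      right
      have ht' : ¬ ∀ p, InBall c r p → contract n p ≠ contract n (LatticeEdge.head e.1) := ht
      push Not at ht'
      obtain ⟨q, hq, hqt⟩ := ht'
      have hs : ¬ InBall c r e.1.1 := fun h => he _ h rfl
      change g (contract n (LatticeEdge.head e.1)) ≤ _
      by_cases hb : InBall c r (LatticeEdge.head e.1)
      · exact hmax _ (onRing_of_adjacent' e.1 ⟨hb, hs⟩) trivial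
      · exact hcase q _ hq hb hqt
    · intro e he
      by_cases ht : (zeroGraph n).src e ∈ D
      · exact Or.inl ht
      right
      have ht' : ¬ ∀ p, InBall c r p → contract n p ≠ contract n e.1.1 := ht
      push Not at ht'
      obtain ⟨q, hq, hqt⟩ := ht'
      have hs : ¬ InBall c r (LatticeEdge.head e.1) := fun h => he _ h rfl
      change g (contract n e.1.1) ≤ _
      by_cases hb : InBall c r e.1.1
      · exact hmax _ (onRing_of_adjacent e.1 ⟨hb, hs⟩) trivial
      · exact hcase q _ hq hb hqt
  · have hvD' : ¬ ∀ p, InBall c r p → contract n p ≠ v := hvD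
    push Not at hvD'
    obtain ⟨q, hq, rfl⟩ := hvD'
    by_cases hqn : q ∈ box n
    · exact absurd hq (hv _ (contract_of_mem hqn))
    · obtain ⟨s, hs, hs'⟩ := exists_onRing_notMem_box hq hqn
      have := hmax s hs trivial
      rwa [contract_of_notMem hs', ← contract_of_notMem hqn] at this

theorem zeroGraph_exists_bad {ε : ℝ} (hε : 0 < ε) :
    ∃ K : ℕ, ∀ (n : ℕ) (v₁ v₂ : (zeroGraph n).V) (ψ : (zeroGraph n).V → ℝ),
      (zeroGraph n).IsPotential ψ v₁ v₂ → ∃ bad : Finset (zeroGraph n).E,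
        bad.card ≤ K ∧ ∀ e, e ∉ bad → |(zeroGraph n).d ψ e| ≤ ε := by
  classical
  obtain ⟨N, hN⟩ := exists_radius hε
  refine ⟨4 * (2 * N + 1) ^ 2, fun n v₁ v₂ ψ hψ => ?_⟩
  change Option (box n) at v₁ v₂
  -- A pole at `∞` has no position in the plane and excludes no edges: `zero_le_onRing` applies to
  -- it at every radius.
  set pts : Option (box n) → Finset (ℤ × ℤ) := fun v => v.elim ∅ fun p => {p.1} with hpts
  have hptc : ∀ v, (pts v).card ≤ 1 := fun v => by cases v <;> simp [hpts]
  set bad : Finset (touchingEdges n) :=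
    Finset.univ.filter fun e => ∃ p ∈ pts v₁ ∪ pts v₂, InBall e.1.1 N p with hbad
  refine ⟨bad, card_near_le _ (pts v₁ ∪ pts v₂) ((Finset.card_union_le _ _).trans
    (add_le_add (hptc _) (hptc _))) N bad fun e he => (Finset.mem_filter.1 he).2, fun e he => ?_⟩
  have hconn := zeroGraph_isConn n
  obtain ⟨x, hx⟩ := RootedGraph.exists_potential hconn ((zeroGraph n).src e) ((zeroGraph n).tgt e)
  set g : Option (box n) → ℝ := (zeroGraph n).toForm x with hgdef
  have hg : (zeroGraph n).IsPotential g ((zeroGraph n).src e) ((zeroGraph n).tgt e) := hx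
  have hrec := hψ.reciprocity hg
  set c := e.1.1 with hc
  have hfar : ∀ v : Option (box n), (v = v₁ ∨ v = v₂) → ∀ p : box n, v = some p →
      ¬ InBall c N p := by
    intro v hv p hp hb
    refine he (Finset.mem_filter.2 ⟨Finset.mem_univ _, p, ?_, hb⟩)
    subst hp
    rcases hv with h | h <;> simp [hpts, ← h]
  have hE : ∀ S : Finset LatticeEdge, ∑ e ∈ S, |zeroIncrement n g e| ^ 2 ≤ 1 := fun S =>
    (zero_energy n g S).trans (hg.energy.le.trans hg.edge_energy_le_one)
  have main : ∀ u v : Option (box n), (u = v₁ ∨ u = v₂) → (v = v₁ ∨ v = v₂) → g u - g v ≤ ε := by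
    intro u v hu hv
    refine hN Set.univ Set.univ Set.ordConnected_univ Set.ordConnected_univ _ _
      (zero_edgeBound n g) hE c (fun r _ => ⟨Or.inl trivial, Or.inl trivial⟩) _ fun r hr hrN => ?_
    have hball := inBall_self e.1 (r := r) (by exact_mod_cast hr)
    have hmono : ∀ p, InBall c r p → InBall c N p := fun p hp => by
      simp only [InBall] at *; omega
    obtain ⟨p, hp, hup⟩ := zero_le_onRing hg (c := c) (r := r) (by omega)
      ⟨_, hball.1, rfl⟩ ⟨_, hball.2, rfl⟩ (v := u) fun p h hp => hfar u hu p h (hmono _ hp)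
    obtain ⟨q, hq, hvq⟩ := zero_le_onRing hg.neg (c := c) (r := r) (by omega)
      ⟨_, hball.2, rfl⟩ ⟨_, hball.1, rfl⟩ (v := v) fun p h hp => hfar v hv p h (hmono _ hp)
    refine ⟨p, q, hp, hq, trivial, trivial, trivial, trivial, ?_⟩
    have hvq' : -g v ≤ -g (contract n q) := hvq
    linarith
  have m1 := main v₁ v₂ (Or.inl rfl) (Or.inr rfl)
  have m2 := main v₂ v₁ (Or.inr rfl) (Or.inl rfl)
  rw [RootedGraph.d, abs_le]
  constructor <;> linarith

/-! #### Free boundary condition -/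

/-- Extension by `0` of a function on the box. -/
noncomputable def extendBox (n : ℕ) (w : box n → ℝ) (p : ℤ × ℤ) : ℝ :=
  if h : p ∈ box n then w ⟨p, h⟩ else 0

theorem extendBox_of_mem {n : ℕ} (w : box n → ℝ) {p : ℤ × ℤ} (h : p ∈ box n) :
    extendBox n w p = w ⟨p, h⟩ := dif_pos h

/-- The increments of a function on the box along the inner edges. -/
noncomputable def freeIncrement (n : ℕ) (w : box n → ℝ) (e : LatticeEdge) : ℝ :=
  if e ∈ innerEdges n then extendBox n w (LatticeEdge.head e) - extendBox n w e.1 else 0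

theorem freeIncrement_coe {n : ℕ} (w : box n → ℝ) (e : (freeGraph n).E) :
    freeIncrement n w (Subtype.val (p := fun e => e ∈ innerEdges n) e) = (freeGraph n).d w e := by
  have he := Subtype.prop (p := fun e => e ∈ innerEdges n) e
  rw [freeIncrement, if_pos he, extendBox_of_mem w (innerEdges_head_mem he),
    extendBox_of_mem w (innerEdges_fst_mem he)]
  rfl

theorem free_edgeBound (n : ℕ) (w : box n → ℝ) :
    EdgeBound (Set.Icc (-(n : ℤ)) n) (Set.Icc (-(n : ℤ)) n) (extendBox n w)
      fun e => |freeIncrement n w e| where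
  nonneg _ := abs_nonneg _
  hor k y hk hk' hy := by
    have he : ((k, y), false) ∈ innerEdges n :=
      mem_innerEdges.2 ⟨mem_box.2 ⟨hk, hy⟩, mem_box.2 ⟨hk', hy⟩⟩
    rw [freeIncrement, if_pos he]
    exact le_rfl
  ver x k hx hk hk' := by
    have he : ((x, k), true) ∈ innerEdges n :=
      mem_innerEdges.2 ⟨mem_box.2 ⟨hx, hk⟩, mem_box.2 ⟨hx, hk'⟩⟩
    rw [freeIncrement, if_pos he]
    exact le_rfl

theorem freeGraph_isConn (n : ℕ) : (freeGraph n).IsConn := by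
  intro w hw u v
  change box n → ℝ at w
  change box n at u v
  have h0 : (fun e => |freeIncrement n w e|) = fun _ => 0 := by
    funext e
    by_cases he : e ∈ innerEdges n
    · rw [abs_eq_zero]
      exact (freeIncrement_coe w ⟨e, he⟩).trans (hw _)
    · rw [freeIncrement, if_neg he, abs_zero]
  have hb := free_edgeBound n w
  rw [h0] at hb
  have hu := mem_box.1 u.2
  have hv := mem_box.1 v.2
  have := hb.eq_of_zero Set.ordConnected_Icc Set.ordConnected_Icc hu.1 hu.2 hv.1 hv.2
  rwa [extendBox_of_mem w u.2, extendBox_of_mem w v.2] at this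

theorem free_energy (n : ℕ) (w : box n → ℝ) (S : Finset LatticeEdge) :
    ∑ e ∈ S, |freeIncrement n w e| ^ 2 ≤ ∑ e : (freeGraph n).E, (freeGraph n).d w e ^ 2 := by
  have h : ∑ e : (freeGraph n).E, (freeGraph n).d w e ^ 2 =
      ∑ e ∈ innerEdges n, freeIncrement n w e ^ 2 := by
    rw [← Finset.sum_coe_sort (innerEdges n) fun e => freeIncrement n w e ^ 2]
    exact Finset.sum_congr rfl fun e _ => by rw [← freeIncrement_coe]
  rw [h]
  simp only [sq_abs]
  rw [← Finset.sum_filter_of_ne (s := S) (p := fun e => e ∈ innerEdges n) fun e _ hne => by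
    by_contra he
    exact hne (by rw [freeIncrement, if_neg he]; norm_num)]
  exact Finset.sum_le_sum_of_subset_of_nonneg (fun e he => (Finset.mem_filter.1 he).2)
    fun e _ _ => sq_nonneg _

/-- Maximum principle outside the ball, as for the zero boundary condition, but only the part of the
ring inside the box is a barrier; hence `hne`. -/
theorem free_le_onRing {n : ℕ} {g : box n → ℝ} {x y : box n}
    (hg : (freeGraph n).IsPotential g x y) {c : ℤ × ℤ} {r : ℤ}
    (hne : ∃ p, OnRing c r p ∧ p ∈ box n) (hx : InBall c r x) (hy : InBall c r y)
    {v : box n} (hv : ¬ InBall c r v) :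
    ∃ p, OnRing c r p ∧ p ∈ box n ∧ g v ≤ extendBox n g p := by
  obtain ⟨p, hp, hpn, hmax⟩ := exists_max_onRing c r (extendBox n g) (box n) hne
  refine ⟨p, hp, hpn, ?_⟩
  refine hg.le_of_boundary (freeGraph_isConn n) {v : box n | ¬ InBall c r v} (fun h => h hx)
    (fun h => h hy) _ ?_ ?_ hv
  · intro e he
    have he' := Subtype.prop (p := fun e => e ∈ innerEdges n) e
    by_cases hb : InBall c r (LatticeEdge.head e.1)
    · right
      have := hmax _ (onRing_of_adjacent' e.1 ⟨hb, he⟩) (innerEdges_head_mem he')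
      rwa [extendBox_of_mem g (innerEdges_head_mem he')] at this
    · exact Or.inl hb
  · intro e he
    have he' := Subtype.prop (p := fun e => e ∈ innerEdges n) e
    by_cases hb : InBall c r e.1.1
    · right
      have := hmax _ (onRing_of_adjacent e.1 ⟨hb, he⟩) (innerEdges_fst_mem he')
      rwa [extendBox_of_mem g (innerEdges_fst_mem he')] at this
    · exact Or.inl hb

theorem freeGraph_exists_bad {ε : ℝ} (hε : 0 < ε) :
    ∃ K : ℕ, ∀ (n : ℕ) (v₁ v₂ : (freeGraph n).V) (ψ : (freeGraph n).V → ℝ),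
      (freeGraph n).IsPotential ψ v₁ v₂ → ∃ bad : Finset (freeGraph n).E,
        bad.card ≤ K ∧ ∀ e, e ∉ bad → |(freeGraph n).d ψ e| ≤ ε := by
  classical
  obtain ⟨N, hN⟩ := exists_radius hε
  -- When `n < N` the rings need not meet the box and every edge is declared bad. The doubled radius
  -- covers this case, since the whole box is then within `2N` of `v₁`.
  refine ⟨4 * (2 * (2 * N) + 1) ^ 2, fun n v₁ v₂ ψ hψ => ?_⟩
  change box n at v₁ v₂
  rcases lt_or_ge n N with hn | hn
  · refine ⟨Finset.univ, card_near_le (innerEdges n) {v₁.1, v₂.1} Finset.card_le_two (2 * N)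
      Finset.univ fun e _ => ⟨v₁.1, by simp, ?_⟩, fun e he => absurd (Finset.mem_univ e) he⟩
    have h1 := mem_box.1 v₁.2
    have h2 := mem_box.1 (innerEdges_fst_mem e.2)
    simp only [InBall]
    push_cast
    omega
  set bad : Finset (innerEdges n) :=
    Finset.univ.filter fun e => ∃ p ∈ ({v₁.1, v₂.1} : Finset (ℤ × ℤ)), InBall e.1.1 N p with hbad
  refine ⟨bad, (card_near_le _ {v₁.1, v₂.1} Finset.card_le_two N bad fun e he =>
    (Finset.mem_filter.1 he).2).trans (by gcongr; omega), fun e he => ?_⟩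
  have hconn := freeGraph_isConn n
  obtain ⟨x, hx⟩ := RootedGraph.exists_potential hconn ((freeGraph n).src e) ((freeGraph n).tgt e)
  set g : box n → ℝ := (freeGraph n).toForm x with hgdef
  have hg : (freeGraph n).IsPotential g ((freeGraph n).src e) ((freeGraph n).tgt e) := hx
  have hrec := hψ.reciprocity hg
  set c := e.1.1 with hc
  have hcn : (-(n : ℤ) ≤ c.1 ∧ c.1 ≤ n) ∧ (-(n : ℤ) ≤ c.2 ∧ c.2 ≤ n) :=
    mem_box.1 (innerEdges_fst_mem (Subtype.prop (p := fun e => e ∈ innerEdges n) e))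
  have hfar : ∀ v : box n, (v = v₁ ∨ v = v₂) → ¬ InBall c N v := by
    intro v hv hb
    refine he (Finset.mem_filter.2 ⟨Finset.mem_univ _, v, ?_, hb⟩)
    rcases hv with h | h <;> simp [h]
  have hE : ∀ S : Finset LatticeEdge, ∑ e ∈ S, |freeIncrement n g e| ^ 2 ≤ 1 := fun S =>
    (free_energy n g S).trans (hg.energy.le.trans hg.edge_energy_le_one)
  have main : ∀ u v : box n, (u = v₁ ∨ u = v₂) → (v = v₁ ∨ v = v₂) → g u - g v ≤ ε := by
    intro u v hu hv
    refine hN _ _ Set.ordConnected_Icc Set.ordConnected_Icc _ _ (free_edgeBound n g) hE c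
      (fun r hr => ?_) _ fun r hr hrN => ?_
    -- Since `c` lies in the box and `r ≤ N ≤ n`, in each coordinate at least one of the two
    -- displacements by `r` stays in `[-n, n]`: the clipped ring keeps a corner.
    · simp only [Set.mem_Icc]
      constructor <;> omega
    have hball := inBall_self e.1 (r := r) (by exact_mod_cast hr)
    have hmono : ∀ p, InBall c r p → InBall c N p := fun p hp => by
      simp only [InBall] at *; omega
    have hne : ∃ p, OnRing c r p ∧ p ∈ box n := by
      obtain ⟨⟨o1, o2⟩, -⟩ := onRing_sides c (r := r) (by omega)
      by_cases h0 : 0 ≤ c.1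
      · exact ⟨_, o2, mem_box.2 (by simp only; omega)⟩
      · exact ⟨_, o1, mem_box.2 (by simp only; omega)⟩
    obtain ⟨p, hp, hpn, hup⟩ := free_le_onRing hg hne hball.1 hball.2 (v := u)
      fun h => hfar u hu (hmono _ h)
    obtain ⟨q, hq, hqn, hvq⟩ := free_le_onRing hg.neg hne hball.2 hball.1 (v := v)
      fun h => hfar v hv (hmono _ h)
    have hp' := mem_box.1 hpn
    have hq' := mem_box.1 hqn
    refine ⟨p, q, hp, hq, hp'.1, hp'.2, hq'.1, hq'.2, ?_⟩
    have hvq' : -g v ≤ -g ⟨q, hqn⟩ := hvq.trans_eq (extendBox_of_mem _ hqn)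
    rw [extendBox_of_mem g hqn]
    linarith
  have m1 := main v₁ v₂ (Or.inl rfl) (Or.inr rfl)
  have m2 := main v₂ v₁ (Or.inr rfl) (Or.inl rfl)
  rw [RootedGraph.d, abs_le]
  constructor <;> linarith

/-! ### Both boundary conditions together, and the conclusion. -/

theorem latticeGraph_isConn (bc : BoundaryCondition) (n : ℕ) : (latticeGraph bc n).IsConn :=
  match bc with
  | .free => freeGraph_isConn n
  | .zero => zeroGraph_isConn n

/-- The current of a unit flow in `Λ_n` is small on all but boundedly many edges. -/
theorem latticeGraph_exists_bad {ε : ℝ} (hε : 0 < ε) :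
    ∃ K : ℕ, ∀ (bc : BoundaryCondition) (n : ℕ) (v₁ v₂ : (latticeGraph bc n).V)
      (ψ : (latticeGraph bc n).V → ℝ), (latticeGraph bc n).IsPotential ψ v₁ v₂ →
        ∃ bad : Finset (latticeGraph bc n).E,
          bad.card ≤ K ∧ ∀ e, e ∉ bad → |(latticeGraph bc n).d ψ e| ≤ ε := by
  obtain ⟨K₁, h₁⟩ := freeGraph_exists_bad hε
  obtain ⟨K₂, h₂⟩ := zeroGraph_exists_bad hε
  refine ⟨max K₁ K₂, fun bc n v₁ v₂ ψ hψ => ?_⟩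
  cases bc with
  | free =>
    obtain ⟨bad, hc, hb⟩ := h₁ n v₁ v₂ ψ hψ
    exact ⟨bad, hc.trans (le_max_left _ _), hb⟩
  | zero =>
    obtain ⟨bad, hc, hb⟩ := h₂ n v₁ v₂ ψ hψ
    exact ⟨bad, hc.trans (le_max_right _ _), hb⟩

theorem errorFunction_nonneg {β : ℝ} (hβ : 0 ≤ β) : 0 ≤ errorFunction β :=
  mul_nonneg (mul_nonneg (sq_nonneg _) hβ) (iInf_varIG_nonneg _)

end VillainModel

theorem mainTheorem1 :
    ∃ K : ℝ, ∀ (bc : VillainModel.BoundaryCondition) (n : ℕ) (β : ℝ), 1 / 3 ≤ β →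
      ∀ v₁ v₂ : (VillainModel.latticeGraph bc n).V,
        (((VillainModel.latticeGraph bc n).villainTwoPoint β v₁ v₂ : ℝ) : ℂ) ≤
            (K : ℂ) * (VillainModel.latticeGraph bc n).gffTwoPoint β v₁ v₂ ^
              ((1 + VillainModel.errorFunction β / 2 : ℝ) : ℂ) ∧
          (VillainModel.latticeGraph bc n).gffTwoPoint β v₁ v₂ ^
              ((1 + VillainModel.errorFunction β / 2 : ℝ) : ℂ) =
            (VillainModel.latticeGraph bc n).gffTwoPoint
              (β / (1 + VillainModel.errorFunction β / 2)) v₁ v₂ := by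
  obtain ⟨N, hN⟩ := VillainModel.latticeGraph_exists_bad (ε := 1 / 20) (by norm_num)
  -- One factor `exp π²` for each possible bad edge; `N` depends only on the threshold `1/20`.
  refine ⟨Real.exp (Real.pi ^ 2 * N), fun bc n β hβ v₁ v₂ => ?_⟩
  have hβ0 : 0 < β := by linarith
  have hconn := VillainModel.latticeGraph_isConn bc n
  obtain ⟨ψ, hψ⟩ := VillainModel.RootedGraph.exists_potential hconn v₁ v₂
  obtain ⟨bad, hcard, hbad⟩ := hN bc n v₁ v₂ _ hψ
  have hvil := VillainModel.RootedGraph.villainTwoPoint_le_of_potential hconn hψ hβ bad hbad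
  have hM := VillainModel.errorFunction_nonneg hβ0.le
  set M := 1 + VillainModel.errorFunction β / 2 with hMdef
  have hM0 : 0 < M := by linarith
  set R := (VillainModel.latticeGraph bc n).toForm ψ v₁ -
    (VillainModel.latticeGraph bc n).toForm ψ v₂ with hR
  have hpow : (VillainModel.latticeGraph bc n).gffTwoPoint β v₁ v₂ ^ ((M : ℝ) : ℂ) =
      ((Real.exp (-R / (2 * β) * M) : ℝ) : ℂ) := by
    rw [VillainModel.RootedGraph.gffTwoPoint_eq hconn hψ hβ0, ← Complex.ofReal_exp,
      ← Complex.ofReal_cpow (Real.exp_pos _).le, ← Real.exp_mul]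
  refine ⟨?_, ?_⟩
  · rw [hpow, ← Complex.ofReal_mul, Complex.real_le_real]
    refine hvil.trans (mul_le_mul_of_nonneg_right (Real.exp_le_exp.2 ?_) (Real.exp_pos _).le)
    have : (bad.card : ℝ) ≤ N := by exact_mod_cast hcard
    gcongr
  · rw [hpow, VillainModel.RootedGraph.gffTwoPoint_eq hconn hψ (div_pos hβ0 hM0),
      Complex.ofReal_exp]
    congr 2
    rw [← hR]
    field_simp
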